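/- Let $q=e^{2\pi i/3}$. **The rotor model on an even cylinder.** A link pattern of size $N$ is a non-crossing perfect matching of $N$ points on the boundary of a disk, and a configuration of size $N$ is a pair $(\pi_R,\pi_G)$ of a red and a green link pattern of size $N$. In a face of the square lattice the lines of one colour form one of two tiles: $\mathsf{a}$, joining south–west and north–east, or $\mathsf{b}$, joining south–east and north–west. A face carries one red and one green tile. Its weight is $$\omega_D(z,w)=q(w-qz)(z+qw)\ \text{ for }(\mathsf a,\mathsf a),\qquad \omega_A(z,w)=(w-z)(w+qz)\ \text{ for }(\mathsf b,\mathsf b),$$ $$\omega_R(z,w)=\omega_L(z,w)=(w-z)(z+qw)\ \text{ for the two mixed pairs.}$$ The transfer matrix $T(t|z_1,\dots,z_{2n})$ acts on the space spanned by the configurations of size $2n$. It glues a cyclic row of $2n$ faces below the configuration, sums over all choices of faces, gives the face in column $j$ the weight $\omega_\bullet(z_j,t)$, and erases closed loops with weight $1$. The ground-state vector $\Psi^{(2n)}=(\Psi_{\pi_R,\pi_G}(z_1,\dots,z_{2n}))$ is a vector of homogeneous polynomials of one common degree with $$T(t|z_1,\dots,z_{2n})\,\Psi^{(2n)}=\prod_{j=1}^{2n}(qt^2-z_j^2)\;\Psi^{(2n)}\qquad\text{for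 all }t .$$ It is subject to the following two requirements. * (Degree assumption.) Its degree in each variable is at most $2(n-1)$, twice the degree of the $O(1)$ ground state $\Psi^{(2n)}_{O(1)}$ in each variable. * (Normalization.) For every red link pattern $\pi_R$, $$\sum_{\pi_G}\Psi_{\pi_R,\pi_G}(z_1,\dots,z_{2n})=\Psi_{O(1),\pi_R}(z_1^2,\dots,z_{2n}^2).$$ Here $\Psi^{(2n)}_{O(1)}$ is the vector of homogeneous polynomials of one common degree, of degree at most $n-1$ in each variable, indexed by the link patterns of size $2n$, that is an eigenvector for all $t$, with eigenvalue $\prod_{j}(qt-z_j)$, of the one-colour transfer matrix with weights $qz_j-t$ for $\mathsf a$ and $q^2(z_j-t)$ for $\mathsf b$ in column $j$. It is normalized so that its maximally nested component (arcs joining $i$ and $2n+1-i$) equals $3^{n(n-1)/2}$ at $z_1=\dots=z_{2n}=1$. **Statement.** Let $n\ge 1$, and let $\Psi^{(2n)}$ and $\Psi^{(2n-2)}$ be ground-state vectors as above. Let $i\in\{1,\dots,2n\}$, with $i+1$ read modulo $2n$. Let $\phi_i$ be the linear map from configurations of size $2n-2$ to configurations of size $2n$ that inserts a red arc and a green arc,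 both joining $i$ and $i+1$, and keeps the order of the remaining points. If $z_{i+1}=-q^2z_i$, then $$\Psi^{(2n)}(z_1,\dots,z_{2n})=\prod_{j\ne i,i+1}q\,(z_{i+1}^2-q^2z_j^2)\;\,\phi_i\,\Psi^{(2n-2)}(\dots,\hat z_i,\hat z_{i+1},\dots),$$ where the hats mean that $z_i$ and $z_{i+1}$ are omitted. -/

import Mathlib

/-!
The rotor model with spectral parameters on a cylinder of even width (periodic boundary
conditions, the hole of the cylinder being ignored), and the fully packed `O(1)` loop model.
-/

namespace RotorModel

/-- `q = exp (2πi/3)`. -/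
noncomputable def q : ℂ := Complex.exp (2 * Real.pi * Complex.I / 3)

/-- Link patterns on `N` points of the boundary of a disk: non-crossing perfect matchings of
`Fin N`, given by the map sending each point to its partner. -/
abbrev LinkPattern (N : ℕ) : Type :=
  {p : Fin N → Fin N // (∀ i, p (p i) = i) ∧ (∀ i, p i ≠ i) ∧
    ∀ i j, ¬ (i < j ∧ j < p i ∧ p i < p j)}

/-- A basis configuration of the rotor model: a red link pattern and a green link pattern. -/
abbrev Configuration (N : ℕ) : Type := LinkPattern N × LinkPattern N

/-- The two ways in which the lines of one colour can pass through a face: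
`sw` joins south to west and north to east, `se` joins south to east and north to west. -/
inductive Tile
  | sw
  | se
  deriving DecidableEq

instance : Fintype Tile := ⟨{.sw, .se}, fun x => by cases x <;> simp⟩

/-- The edges of one row of `N` faces on the cylinder: the northern edge and the southern edge of
each column, and `side j`, the western edge of column `j`, which is the eastern edge of the
cyclically preceding column. -/
inductive Edge (N : ℕ)
  | north (j : Fin N)
  | south (j : Fin N)
  | side (j : Fin N)

/-- The elementary connections after a row `s` of tiles has been glued below a configuration in
which the northern edges are paired by the link pattern `p`. -/
inductive Joined {N : ℕ} (s : Fin N → Tile) (p : LinkPattern N) : Edge N → Edge N → Prop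
  | pattern (j : Fin N) : Joined s p (.north j) (.north (p.1 j))
  | south_west (j : Fin N) : s j = .sw → Joined s p (.south j) (.side j)
  | north_east (j : Fin N) : s j = .sw → Joined s p (.north j) (.side (finRotate N j))
  | south_east (j : Fin N) : s j = .se → Joined s p (.south j) (.side (finRotate N j))
  | north_west (j : Fin N) : s j = .se → Joined s p (.north j) (.side j)

/-- Adding the row `s` turns the link pattern `p` of the northern points into the link pattern `p'`
of the southern points (closed loops are erased with weight `1`). -/
def AddRow {N : ℕ} (s : Fin N → Tile) (p p' : LinkPattern N) : Prop :=
  ∀ j : Fin N, Relation.EqvGen (Joined s p) (.south j) (.south (p'.1 j))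

/-! ### The rotor model -/

noncomputable def omegaR (z w : ℂ) : ℂ := (w - z) * (z + q * w)

noncomputable def omegaL (z w : ℂ) : ℂ := (w - z) * (z + q * w)

noncomputable def omegaD (z w : ℂ) : ℂ := q * (w - q * z) * (z + q * w)

noncomputable def omegaA (z w : ℂ) : ℂ := (w - z) * (w + q * z)

/-- The weight of a face in which the red lines form the first tile and the green lines the second.
The four faces `D, A, R, L` are the four pairs of tiles. Which of the two mixed pairs is `R`
depends on the parity of the face, but `R` and `L` have the same weight. -/
noncomputable def faceWeight (z w : ℂ) : Tile → Tile → ℂ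
  | .sw, .sw => omegaD z w
  | .se, .se => omegaA z w
  | .sw, .se => omegaR z w
  | .se, .sw => omegaL z w

open Classical in
/-- The one-row transfer matrix `T(t | z) = Tr R(z₁, t) ⋯ R(z_N, t)`; the entry with indices
`π'`, `π` is the total weight of the rows of faces that turn `π` into `π'`. -/
noncomputable def transferMatrix {N : ℕ} (t : ℂ) (z : Fin N → ℂ) :
    Matrix (Configuration N) (Configuration N) ℂ :=
  Matrix.of fun π' π => ∑ r : Fin N → Tile, ∑ g : Fin N → Tile,
    if AddRow r π.1 π'.1 ∧ AddRow g π.2 π'.2 then ∏ j, faceWeight (z j) t (r j) (g j) else 0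

/-! ### The fully packed `O(1)` loop model -/

/-- The face weights of the `O(1)` model. -/
noncomputable def faceWeightO1 (z w : ℂ) : Tile → ℂ
  | .sw => q * z - w
  | .se => q ^ 2 * (z - w)

open Classical in
/-- The transfer matrix of the `O(1)` model. -/
noncomputable def transferMatrixO1 {N : ℕ} (t : ℂ) (z : Fin N → ℂ) :
    Matrix (LinkPattern N) (LinkPattern N) ℂ :=
  Matrix.of fun π' π => ∑ s : Fin N → Tile,
    if AddRow s π π' then ∏ j, faceWeightO1 (z j) t (s j) else 0

/-- The maximally nested link pattern, joining `i` to `2n + 1 - i` (for points numbered from `1`). -/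
def nested (n : ℕ) : LinkPattern (2 * n) :=
  ⟨Fin.rev, fun i => Fin.rev_rev i,
    fun i h => by
      have h1 := congrArg Fin.val h
      rw [Fin.val_rev] at h1
      omega,
    fun i j h => by
      simp only [Fin.lt_def, Fin.val_rev] at h
      omega⟩

/-- `Φ` is the polynomial ground state of the `O(1)` model of size `2n`, of degree `n - 1` in each
variable, normalised by the value of its maximally nested component at `z₁ = ⋯ = z_{2n} = 1`. -/
structure IsGroundStateO1 (n : ℕ) (Φ : LinkPattern (2 * n) → MvPolynomial (Fin (2 * n)) ℂ) :
    Prop where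
  eigenvector : ∀ (t : ℂ) (z : Fin (2 * n) → ℂ),
    (transferMatrixO1 t z).mulVec (fun π => MvPolynomial.eval z (Φ π)) =
      (∏ j, (q * t - z j)) • fun π => MvPolynomial.eval z (Φ π)
  homogeneous : ∃ d, ∀ π, (Φ π).IsHomogeneous d
  degree : ∀ π j, (Φ π).degreeOf j ≤ n - 1
  normalised : MvPolynomial.eval 1 (Φ (nested n)) = 3 ^ (n * (n - 1) / 2)

/-- `Ψ` is the polynomial ground state of the rotor model of size `2n`: a homogeneous polynomial
eigenvector of all transfer matrices whose degree in each variable is twice that of the `O(1)`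
ground state, normalised such that summing over the green link patterns gives the `O(1)` ground
state in the squared variables. -/
structure IsGroundState (n : ℕ) (Ψ : Configuration (2 * n) → MvPolynomial (Fin (2 * n)) ℂ) :
    Prop where
  eigenvector : ∀ (t : ℂ) (z : Fin (2 * n) → ℂ),
    (transferMatrix t z).mulVec (fun π => MvPolynomial.eval z (Ψ π)) =
      (∏ j, (q * t ^ 2 - z j ^ 2)) • fun π => MvPolynomial.eval z (Ψ π)
  homogeneous : ∃ d, ∀ π, (Ψ π).IsHomogeneous d
  degree : ∀ π j, (Ψ π).degreeOf j ≤ 2 * (n - 1)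
  normalised : ∃ Φ, IsGroundStateO1 n Φ ∧ ∀ (ρ : LinkPattern (2 * n)) (z : Fin (2 * n) → ℂ),
    ∑ γ : LinkPattern (2 * n), MvPolynomial.eval z (Ψ (ρ, γ)) =
      MvPolynomial.eval (fun j => z j ^ 2) (Φ ρ)

/-! ### Insertion of arcs -/

/-- The increasing enumeration of the points other than `i` and its cyclic successor. -/
def skip {m : ℕ} (i : Fin (m + 2)) (j : Fin m) : Fin (m + 2) :=
  if i = Fin.last (m + 1) then ⟨j + 1, by omega⟩
  else if (j : ℕ) < i then ⟨j, by omega⟩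
  else ⟨j + 2, by omega⟩

/-- `p'` is `p` with one arc inserted, joining `i` and its cyclic successor. -/
def IsInsertion {m : ℕ} (i : Fin (m + 2)) (p : LinkPattern m) (p' : LinkPattern (m + 2)) : Prop :=
  p'.1 i = finRotate (m + 2) i ∧ ∀ j, p'.1 (skip i j) = skip i (p.1 j)

open Classical in
/-- The linear map `φ_i`, which inserts a red and a green arc joining `i` and its cyclic
successor. -/
noncomputable def insertArcs {m : ℕ} (i : Fin (m + 2)) :
    (Configuration m → ℂ) →ₗ[ℂ] (Configuration (m + 2) → ℂ) :=
  Matrix.mulVecLin (Matrix.of fun π ρ =>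
    if IsInsertion i ρ.1 π.1 ∧ IsInsertion i ρ.2 π.2 then 1 else 0)

end RotorModel

namespace RotorModel

/-! Put z_{i+1} = -q² z_i. At t = z_{i+1} only the pair (b, b) has non-zero weight in column i, and
only (a, a) in column i+1. Such columns create a red and a green arc joining i and i+1, so by the
eigenvalue equation Ψ^{(2n)} is supported on the image of φ_i, as long as the eigenvalue is not zero
(`eq_zero_of_forall_insertArc_ne`). For every t the two columns below such arcs act by a scalar
(`sum_faceWeight_pair`, `transferMatrix_insertArc`). Hence the restriction of Ψ^{(2n)} to this image
is an eigenvector for the other 2n-2 columns, with the eigenvalue of Ψ^{(2n-2)}.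

For proportionality, take the remaining parameters in `regime`. There the weights at t = 1, divided
by q - z², are probabilities, and the transfer matrix becomes substochastic with a positive row. Its
eigenspace for the eigenvalue 1 therefore has dimension at most one (`eq_zero_of_smallArcs`).

The constant is read off from one sum over green patterns. By the normalization this is a component
of the O(1) ground state in the squared variables, where z_{i+1}² = q z_i². The red pattern is the
rotated nested pattern whose outermost arc joins i and i+1. Its O(1) component is an explicit
product: vanishing forces linear factors, the degree bound leaves no room for others, and the value
at 1 fixes the scalar (`IsGroundStateO1.eval_rotatedNested_eq`). The quotient of two such products
is the prefactor.

Both sides are polynomials and `regime` is infinite, so the identity holds for all parameters. -/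

/-! ### Connectivity through colourings -/

/-- Two points are equivalent iff no invariant two-colouring separates them. -/
theorem eqvGen_iff_colouring {α : Type*} {R : α → α → Prop} {a b : α} :
    Relation.EqvGen R a b ↔ ∀ f : α → Prop, (∀ x y, R x y → (f x ↔ f y)) → (f a ↔ f b) := by
  constructor
  · intro h f hf
    induction h with
    | rel x y h => exact hf x y h
    | refl x => exact Iff.rfl
    | symm x y _ ih => exact ih.symm
    | trans x y z _ _ ih1 ih2 => exact ih1.trans ih2
  · intro h
    exact (h (fun x => Relation.EqvGen R a x)
      (fun x y hxy => ⟨fun hx => hx.trans _ _ _ (.rel _ _ hxy),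
        fun hy => hy.trans _ _ _ (.symm _ _ (.rel _ _ hxy))⟩)).1 (.refl a)

/-- A two-colouring of the edges which is constant along the lines of a row. -/
structure IsColouring {N : ℕ} (s : Fin N → Tile) (p : LinkPattern N) (f : Edge N → Prop) :
    Prop where
  pattern : ∀ j, f (.north j) ↔ f (.north (p.1 j))
  south_west : ∀ j, s j = .sw → (f (.south j) ↔ f (.side j))
  north_east : ∀ j, s j = .sw → (f (.north j) ↔ f (.side (finRotate N j)))
  south_east : ∀ j, s j = .se → (f (.south j) ↔ f (.side (finRotate N j)))
  north_west : ∀ j, s j = .se → (f (.north j) ↔ f (.side j))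

theorem isColouring_iff {N : ℕ} {s : Fin N → Tile} {p : LinkPattern N} {f : Edge N → Prop} :
    IsColouring s p f ↔ ∀ x y, Joined s p x y → (f x ↔ f y) := by
  constructor
  · rintro h _ _ (j | ⟨j, hj⟩ | ⟨j, hj⟩ | ⟨j, hj⟩ | ⟨j, hj⟩)
    exacts [h.pattern j, h.south_west j hj, h.north_east j hj, h.south_east j hj,
      h.north_west j hj]
  · intro h
    exact ⟨fun j => h _ _ (.pattern j), fun j hj => h _ _ (.south_west j hj),
      fun j hj => h _ _ (.north_east j hj), fun j hj => h _ _ (.south_east j hj),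
      fun j hj => h _ _ (.north_west j hj)⟩

/-- This is the working form of `AddRow`: a connection is used by exhibiting one suitable colouring,
and established by following an arbitrary colouring along the tiles. -/
theorem addRow_iff {N : ℕ} {s : Fin N → Tile} {p p' : LinkPattern N} :
    AddRow s p p' ↔ ∀ f, IsColouring s p f → ∀ j, (f (.south j) ↔ f (.south (p'.1 j))) := by
  simp only [AddRow, eqvGen_iff_colouring, isColouring_iff]
  exact ⟨fun h f hf j => h j f hf, fun h j f hf => h f hf j⟩

/-- Adjacent tiles `se`, `sw` create a small arc. -/
theorem AddRow.small_arc {N : ℕ} {s : Fin N → Tile} {p p' : LinkPattern N} (h : AddRow s p p')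
    {k : Fin N} (h1 : s k = .se) (h2 : s (finRotate N k) = .sw) : p'.1 k = finRotate N k := by
  have key := (addRow_iff.1 h (fun e => e = .south k ∨ e = .south (finRotate N k) ∨
    e = .side (finRotate N k)) ?_ k).1 (Or.inl rfl)
  · have := p'.2.2.1 k
    simpa [this] using key
  · constructor
    · intro j; simp
    · intro j hj
      have : j ≠ k := by rintro rfl; simp [h1] at hj
      simp [this]
    · intro j hj
      have : j ≠ k := by rintro rfl; simp [h1] at hj
      simp [this]
    · intro j hj
      have : j ≠ finRotate N k := by rintro rfl; simp [h2, -finRotate_apply] at hj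
      simp [this, -finRotate_apply]
    · intro j hj
      have : j ≠ finRotate N k := by rintro rfl; simp [h2, -finRotate_apply] at hj
      simp [this, -finRotate_apply]

/-- A row of tiles `sw` rotates the link pattern. -/
theorem addRow_sw_iff {N : ℕ} {p p' : LinkPattern N} :
    AddRow (fun _ => .sw) p p' ↔ ∀ j, p'.1 (finRotate N j) = finRotate N (p.1 j) := by
  constructor
  · intro h j
    have key := (addRow_iff.1 h (fun e => match e with
      | .north k => k = j ∨ k = p.1 j
      | .south k => k = finRotate N j ∨ k = finRotate N (p.1 j)
      | .side k => k = finRotate N j ∨ k = finRotate N (p.1 j)) ?_ (finRotate N j)).1 (Or.inl rfl)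
    · exact key.resolve_left (p'.2.2.1 _)
    · constructor
      · intro k
        have h1 : p.1 k = j ↔ k = p.1 j :=
          ⟨fun h => by rw [← h, p.2.1], fun h => by rw [h, p.2.1]⟩
        have h2 : p.1 k = p.1 j ↔ k = j :=
          ⟨fun h => by rw [← p.2.1 k, h, p.2.1], fun h => by rw [h]⟩
        simp only [h1, h2]
        exact or_comm
      · intro k _; exact Iff.rfl
      · intro k _; simp
      · intro k hk; cases hk
      · intro k hk; cases hk
  · intro h
    rw [addRow_iff]
    intro f hf j
    obtain ⟨j, rfl⟩ := (finRotate N).surjective j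
    rw [h, hf.south_west _ rfl, hf.south_west _ rfl, ← hf.north_east _ rfl,
      ← hf.north_east _ rfl]
    exact hf.pattern j

/-! ### The pattern below a row is unique -/

/-- The dihedral relation: conjugation by b inverts ab. -/
theorem mul_zpow_of_involutions {α : Type*} (a b : Equiv.Perm α) (hb : ∀ x, b (b x) = x)
    (ha : ∀ x, a (a x) = x) (k : ℤ) : b * (a * b) ^ k = (a * b) ^ (-k) * b := by
  have hb1 : b⁻¹ = b := by ext x; rw [Equiv.Perm.inv_eq_iff_eq, hb]
  have ha1 : a⁻¹ = a := by ext x; rw [Equiv.Perm.inv_eq_iff_eq, ha]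
  have : b * (a * b) * b⁻¹ = (a * b)⁻¹ := by
    rw [mul_inv_rev, ha1, mul_assoc, mul_assoc, mul_inv_cancel, mul_one, hb1]
  rw [zpow_neg, ← inv_zpow, ← this, conj_zpow]
  simp

/-- In an orbit of the group generated by two involutions `a` and `b`, at most two points are
fixed by `b`. -/
theorem fixed_points_of_involutions {α : Type*} (a b : Equiv.Perm α)
    (hb : ∀ x, b (b x) = x) (ha : ∀ x, a (a x) = x) {x y y' : α} (hx : b x = x) (hy : b y = y)
    (hy' : b y' = y') (h : ∃ k : ℤ, ((a * b) ^ k) x = y) (h' : ∃ k : ℤ, ((a * b) ^ k) x = y')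
    (hxy : y ≠ x) (hxy' : y' ≠ x) : y = y' := by
  obtain ⟨k, rfl⟩ := h
  obtain ⟨l, rfl⟩ := h'
  have hconj := mul_zpow_of_involutions a b hb ha
  -- If b fixes both x and (ab)^k x, the dihedral relation gives (ab)^{2k} x = x. So k is half a
  -- multiple of the period, an odd one when (ab)^k x ≠ x, and two such exponents differ by a
  -- multiple of the period.
  have hfix : ∀ k : ℤ, b (((a * b) ^ k) x) = ((a * b) ^ k) x →
      (Function.minimalPeriod (a * b) x : ℤ) ∣ 2 * k := by
    intro k hk
    have h1 := congrArg (fun e : Equiv.Perm α => e x) (hconj k)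
    simp only [Equiv.Perm.mul_apply, hx] at h1
    rw [hk] at h1
    have h2 : ((a * b) ^ (2 * k)) x = x := by
      rw [two_mul, zpow_add, Equiv.Perm.mul_apply, h1, ← Equiv.Perm.mul_apply, ← zpow_add]
      simp
    exact MulAction.zpow_smul_eq_iff_minimalPeriod_dvd (a := a * b).1 h2
  have hne : ∀ k : ℤ, ((a * b) ^ k) x ≠ x → ¬ (Function.minimalPeriod (a * b) x : ℤ) ∣ k := by
    intro k hk hd
    exact hk (MulAction.zpow_smul_eq_iff_minimalPeriod_dvd (a := a * b).2 hd)
  obtain ⟨u, hu⟩ := hfix k hy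
  obtain ⟨v, hv⟩ := hfix l hy'
  have hk := hne k hxy
  have hl := hne l hxy'
  have hu' : Odd u := by
    rw [← Int.not_even_iff_odd]
    rintro ⟨w, rfl⟩
    exact hk ⟨w, by linarith⟩
  have hv' : Odd v := by
    rw [← Int.not_even_iff_odd]
    rintro ⟨w, rfl⟩
    exact hl ⟨w, by linarith⟩
  obtain ⟨w, hw⟩ := hu'.sub_odd hv'
  by_contra hne'
  have hkl : ((a * b) ^ (l - k)) x ≠ x := by
    intro h0
    apply hne'
    conv_lhs => rw [← h0]
    rw [← Equiv.Perm.mul_apply, ← zpow_add]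
    congr 2
    ring
  refine hne _ hkl ⟨-w, ?_⟩
  have : u = v + (w + w) := by linarith
  subst this
  linarith

/-- The ends of the arcs of a row: the upper and lower side of the northern edges, the southern
edges, and the western and eastern side of each column. -/
inductive Flag (N : ℕ)
  | top (j : Fin N)
  | bottom (j : Fin N)
  | south (j : Fin N)
  | left (j : Fin N)
  | right (j : Fin N)

namespace Flag

variable {N : ℕ}

/-- The other end of the arc. -/
def arc (s : Fin N → Tile) (p : LinkPattern N) : Flag N → Flag N
  | top j => top (p.1 j)
  | bottom j => match s j with
    | .sw => right j
    | .se => left j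
  | south j => match s j with
    | .sw => left j
    | .se => right j
  | left j => match s j with
    | .sw => south j
    | .se => bottom j
  | right j => match s j with
    | .sw => bottom j
    | .se => south j

theorem arc_arc (s : Fin N → Tile) (p : LinkPattern N) (x : Flag N) :
    arc s p (arc s p x) = x := by
  cases x with
  | top j => simp [arc, p.2.1]
  | _ j => cases h : s j <;> simp [arc, h]

/-- The other side of the edge. -/
def flip : Flag N → Flag N
  | top j => bottom j
  | bottom j => top j
  | south j => south j
  | left j => right ((finRotate N).symm j)
  | right j => left (finRotate N j)

theorem flip_flip (x : Flag N) : flip (flip x) = x := by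
  cases x <;> simp [flip, -finRotate_apply, -finRotate_symm_apply]

end Flag

/-- The lines of a row are the orbits of the group generated by `arc` and `flip`, and the fixed
points of `flip` are the southern edges. A line starting at one southern edge thus has at most one
other southern end. -/
theorem AddRow.unique {N : ℕ} {s : Fin N → Tile} {p p' p'' : LinkPattern N} (h' : AddRow s p p')
    (h'' : AddRow s p p'') : p' = p'' := by
  let a : Equiv.Perm (Flag N) := ⟨Flag.arc s p, Flag.arc s p, Flag.arc_arc s p, Flag.arc_arc s p⟩
  let b : Equiv.Perm (Flag N) := ⟨Flag.flip, Flag.flip, Flag.flip_flip, Flag.flip_flip⟩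
  have ha : ∀ x, a (a x) = x := Flag.arc_arc s p
  have hb : ∀ x, b (b x) = x := Flag.flip_flip
  have reach : ∀ {p' : LinkPattern N}, AddRow s p p' → ∀ j,
      ∃ k : ℤ, ((a * b) ^ k) (.south j) = .south (p'.1 j) := by
    intro p' h j
    set P := a * b with hP
    have hstep : ∀ x, (∃ k : ℤ, (P ^ k) (.south j) = b x) → ∃ k : ℤ, (P ^ k) (.south j) = a x := by
      rintro x ⟨k, hk⟩
      refine ⟨k + 1, ?_⟩
      rw [add_comm, zpow_add, Equiv.Perm.mul_apply, hk, zpow_one, hP, Equiv.Perm.mul_apply, hb]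
    -- The orbit of `south j` under P alone is closed under b, because b inverts P and fixes `south
    -- j`.
    have hflip : ∀ x, (∃ k : ℤ, (P ^ k) (.south j) = x) → ∃ k : ℤ, (P ^ k) (.south j) = b x := by
      rintro x ⟨k, rfl⟩
      refine ⟨-k, ?_⟩
      have := congrArg (fun e : Equiv.Perm (Flag N) => e (.south j))
        (mul_zpow_of_involutions a b hb ha k)
      exact this.symm
    have hflip' : ∀ x, (∃ k : ℤ, (P ^ k) (.south j) = b x) ↔ ∃ k : ℤ, (P ^ k) (.south j) = x :=
      fun x => ⟨fun h => by simpa only [hb] using hflip _ h, hflip x⟩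
    have harc : ∀ x y, a x = y →
        ((∃ k : ℤ, (P ^ k) (.south j) = x) ↔ ∃ k : ℤ, (P ^ k) (.south j) = y) := by
      rintro x _ rfl
      refine ⟨fun h => hstep _ (hflip _ h), fun h => ?_⟩
      simpa only [ha] using hstep _ (hflip _ h)
    refine (addRow_iff.1 h (fun e => match e with
      | .north k => ∃ n : ℤ, (P ^ n) (.south j) = .top k
      | .south k => ∃ n : ℤ, (P ^ n) (.south j) = .south k
      | .side k => ∃ n : ℤ, (P ^ n) (.south j) = .left k) ?_ j).1 ⟨0, rfl⟩
    constructor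
    · exact fun k => harc (.top k) _ rfl
    · exact fun k hk => harc (.south k) _ (by simp [a, Flag.arc, hk])
    · exact fun k hk => (hflip' (.bottom k)).trans
        ((harc (.bottom k) (.right k) (by simp [a, Flag.arc, hk])).trans (hflip' (.right k)).symm)
    · exact fun k hk => (harc (.south k) (.right k) (by simp [a, Flag.arc, hk])).trans
        (hflip' (.right k)).symm
    · exact fun k hk => (hflip' (.bottom k)).trans
        (harc (.bottom k) (.left k) (by simp [a, Flag.arc, hk]))
  apply Subtype.ext
  funext j
  have := fixed_points_of_involutions a b hb ha (x := .south j) rfl rfl rfl (reach h' j)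
    (reach h'' j) (by simpa using p'.2.2.1 j) (by simpa using p''.2.2.1 j)
  simpa using this

/-! ### Insertion of an arc -/

theorem val_finRotate {N : ℕ} (i : Fin N) :
    (finRotate N i : ℕ) = if (i : ℕ) + 1 = N then 0 else (i : ℕ) + 1 := by
  obtain _ | N := N
  · exact i.elim0
  · rw [coe_finRotate]
    simp [Fin.ext_iff]

theorem val_skip {m : ℕ} (i : Fin (m + 2)) (j : Fin m) :
    (skip i j : ℕ) = if (i : ℕ) = m + 1 then (j : ℕ) + 1 else if (j : ℕ) < i then (j : ℕ)
      else (j : ℕ) + 2 := by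
  unfold skip
  simp only [Fin.ext_iff, Fin.val_last]
  split_ifs <;> rfl

theorem finRotate_ne {m : ℕ} (i : Fin (m + 2)) : finRotate (m + 2) i ≠ i := by
  rw [Ne, Fin.ext_iff, val_finRotate]
  split_ifs <;> omega

theorem skip_lt_skip {m : ℕ} (i : Fin (m + 2)) {j k : Fin m} :
    skip i j < skip i k ↔ j < k := by
  rw [Fin.lt_def, Fin.lt_def, val_skip, val_skip]
  split_ifs <;> omega

theorem skip_injective {m : ℕ} (i : Fin (m + 2)) : Function.Injective (skip i) :=
  (show StrictMono (skip i) from fun _ _ h => (skip_lt_skip i).2 h).injective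

theorem skip_ne {m : ℕ} (i : Fin (m + 2)) (j : Fin m) : skip i j ≠ i := by
  rw [Ne, Fin.ext_iff, val_skip]
  split_ifs <;> omega

theorem skip_ne_finRotate {m : ℕ} (i : Fin (m + 2)) (j : Fin m) :
    skip i j ≠ finRotate (m + 2) i := by
  rw [Ne, Fin.ext_iff]
  have h1 := val_skip i j
  have h2 := val_finRotate i
  split_ifs at h1 h2 <;> omega

theorem exists_skip_eq {m : ℕ} {i k : Fin (m + 2)} (h : k ≠ i) (h' : k ≠ finRotate (m + 2) i) :
    ∃ j, skip i j = k := by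
  rw [Ne, Fin.ext_iff] at h h'
  rw [val_finRotate] at h'
  have hk := k.2
  have hi := i.2
  by_cases hl : (i : ℕ) = m + 1
  · rw [if_pos (by omega)] at h'
    exact ⟨⟨k - 1, by omega⟩, by rw [Fin.ext_iff, val_skip, if_pos hl]; simp only; omega⟩
  · rw [if_neg (by omega)] at h'
    by_cases hki : (k : ℕ) < i
    · exact ⟨⟨k, by omega⟩, by rw [Fin.ext_iff, val_skip, if_neg hl, if_pos hki]⟩
    · exact ⟨⟨k - 2, by omega⟩, by
        rw [Fin.ext_iff, val_skip, if_neg hl, if_neg (by simp only; omega)]; simp only; omega⟩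

/-- Cyclic neighbours stay neighbours, except across the inserted pair, where i and its successor
lie between them. -/
theorem finRotate_skip {m : ℕ} (i : Fin (m + 2)) (k : Fin m) :
    finRotate (m + 2) (skip i k) = skip i (finRotate m k) ∨
      finRotate (m + 2) (skip i k) = i ∧
        skip i (finRotate m k) = finRotate (m + 2) (finRotate (m + 2) i) := by
  simp only [Fin.ext_iff, val_skip, val_finRotate]
  have := k.2
  have := i.2
  split_ifs <;> omega

/-- The points other than `i` and its successor, together with these two. -/
noncomputable def skipEquiv {m : ℕ} (i : Fin (m + 2)) : Option (Option (Fin m)) ≃ Fin (m + 2) :=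
  Equiv.ofBijective (fun o => o.elim i fun o => o.elim (finRotate (m + 2) i) (skip i)) (by
    constructor
    · rintro (_ | _ | a) (_ | _ | b) h
      · rfl
      · exact absurd h (finRotate_ne i).symm
      · exact absurd h (skip_ne i b).symm
      · exact absurd h (finRotate_ne i)
      · rfl
      · exact absurd h (skip_ne_finRotate i b).symm
      · exact absurd h (skip_ne i a)
      · exact absurd h (skip_ne_finRotate i a)
      · rw [skip_injective i h]
    · intro k
      by_cases h : k = i
      · exact ⟨none, h.symm⟩
      by_cases h' : k = finRotate (m + 2) i
      · exact ⟨some none, h'.symm⟩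
      obtain ⟨j, hj⟩ := exists_skip_eq h h'
      exact ⟨some (some j), hj⟩)

@[simp] theorem skipEquiv_none {m : ℕ} (i : Fin (m + 2)) : skipEquiv i none = i := rfl

@[simp] theorem skipEquiv_some_none {m : ℕ} (i : Fin (m + 2)) :
    skipEquiv i (some none) = finRotate (m + 2) i := rfl

@[simp] theorem skipEquiv_some_some {m : ℕ} (i : Fin (m + 2)) (k : Fin m) :
    skipEquiv i (some (some k)) = skip i k := rfl

@[elab_as_elim]
theorem skip_cases {m : ℕ} (i : Fin (m + 2)) {P : Fin (m + 2) → Prop} (h1 : P i)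
    (h2 : P (finRotate (m + 2) i)) (h3 : ∀ k, P (skip i k)) (j : Fin (m + 2)) : P j := by
  obtain ⟨o | o | k, rfl⟩ := (skipEquiv i).surjective j
  exacts [h1, h2, h3 k]

theorem IsInsertion.apply_finRotate {m : ℕ} {i : Fin (m + 2)} {p : LinkPattern m}
    {p' : LinkPattern (m + 2)} (h : IsInsertion i p p') : p'.1 (finRotate (m + 2) i) = i := by
  rw [← h.1, p'.2.1]

/-- The partner function after the insertion of an arc joining `i` and its successor. -/
noncomputable def insertFun {m : ℕ} (i : Fin (m + 2)) (p : Fin m → Fin m) (j : Fin (m + 2)) :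
    Fin (m + 2) :=
  skipEquiv i (match (skipEquiv i).symm j with
    | none => some none
    | some none => none
    | some (some k) => some (some (p k)))

theorem insertFun_self {m : ℕ} (i : Fin (m + 2)) (p : Fin m → Fin m) :
    insertFun i p i = finRotate (m + 2) i := by
  have : (skipEquiv i).symm i = none := by rw [Equiv.symm_apply_eq]; rfl
  simp only [insertFun, this, skipEquiv_some_none]

theorem insertFun_finRotate {m : ℕ} (i : Fin (m + 2)) (p : Fin m → Fin m) :
    insertFun i p (finRotate (m + 2) i) = i := by
  have : (skipEquiv i).symm (finRotate (m + 2) i) = some none := by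
    rw [Equiv.symm_apply_eq]; rfl
  simp only [insertFun, this, skipEquiv_none]

theorem insertFun_skip {m : ℕ} (i : Fin (m + 2)) (p : Fin m → Fin m) (k : Fin m) :
    insertFun i p (skip i k) = skip i (p k) := by
  have : (skipEquiv i).symm (skip i k) = some (some k) := by rw [Equiv.symm_apply_eq]; rfl
  simp only [insertFun, this, skipEquiv_some_some]

/-- The insertion of an arc joining `i` and its successor. -/
noncomputable def insertArc {m : ℕ} (i : Fin (m + 2)) (p : LinkPattern m) :
    LinkPattern (m + 2) :=
  ⟨insertFun i p.1, by
    intro j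
    induction j using skip_cases i with
    | h1 => rw [insertFun_self, insertFun_finRotate]
    | h2 => rw [insertFun_finRotate, insertFun_self]
    | h3 k => rw [insertFun_skip, insertFun_skip, p.2.1], by
    intro j
    induction j using skip_cases i with
    | h1 => rw [insertFun_self]; exact finRotate_ne i
    | h2 => rw [insertFun_finRotate]; exact (finRotate_ne i).symm
    | h3 k => rw [insertFun_skip]; exact fun h => p.2.2.1 k (skip_injective i h), by
    rintro a b ⟨h1, h2, h3⟩
    have hr := val_finRotate i
    induction a using skip_cases i with
    | h1 =>
      rw [insertFun_self] at h2 h3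
      rw [Fin.lt_def] at h1 h2 h3
      split_ifs at hr <;> omega
    | h2 =>
      rw [insertFun_finRotate] at h2 h3
      rw [Fin.lt_def] at h1 h2 h3
      have := (insertFun i p.1 b).2
      split_ifs at hr <;> omega
    | h3 k =>
      rw [insertFun_skip] at h2 h3
      have hn1 := skip_ne i (p.1 k)
      have hn2 := skip_ne_finRotate i (p.1 k)
      rw [Ne, Fin.ext_iff] at hn1 hn2
      induction b using skip_cases i with
      | h1 =>
        rw [insertFun_self] at h3
        rw [Fin.lt_def] at h1 h2 h3
        split_ifs at hr <;> omega
      | h2 =>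
        rw [insertFun_finRotate] at h3
        rw [Fin.lt_def] at h1 h2 h3
        split_ifs at hr <;> omega
      | h3 l =>
        rw [insertFun_skip] at h3
        rw [skip_lt_skip] at h1 h2 h3
        exact p.2.2.2 k l ⟨h1, h2, h3⟩⟩

theorem isInsertion_iff {m : ℕ} {i : Fin (m + 2)} {p : LinkPattern m} {p' : LinkPattern (m + 2)} :
    IsInsertion i p p' ↔ p' = insertArc i p := by
  constructor
  · intro h
    apply Subtype.ext
    funext j
    change _ = insertFun i p.1 j
    induction j using skip_cases i with
    | h1 => rw [insertFun_self, h.1]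
    | h2 => rw [insertFun_finRotate, h.apply_finRotate]
    | h3 k => rw [insertFun_skip, h.2]
  · rintro rfl
    exact ⟨insertFun_self i _, insertFun_skip i _⟩

theorem isInsertion_insertArc {m : ℕ} (i : Fin (m + 2)) (p : LinkPattern m) :
    IsInsertion i p (insertArc i p) := isInsertion_iff.2 rfl

theorem insertArc_injective {m : ℕ} (i : Fin (m + 2)) : Function.Injective (insertArc i) := by
  intro p q h
  apply Subtype.ext
  funext j
  apply skip_injective i
  rw [← (isInsertion_insertArc i p).2, ← (isInsertion_insertArc i q).2, h]

theorem exists_insertArc_eq {m : ℕ} {i : Fin (m + 2)} {p' : LinkPattern (m + 2)}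
    (h : p'.1 i = finRotate (m + 2) i) : ∃ p, insertArc i p = p' := by
  have h' : p'.1 (finRotate (m + 2) i) = i := by rw [← h, p'.2.1]
  have hex : ∀ k, ∃ l, skip i l = p'.1 (skip i k) := by
    intro k
    apply exists_skip_eq
    · intro hk
      exact skip_ne_finRotate i k (by rw [← p'.2.1 (skip i k), hk, h])
    · intro hk
      exact skip_ne i k (by rw [← p'.2.1 (skip i k), hk, h'])
  choose p hp using hex
  refine ⟨⟨p, fun k => skip_injective i ?_, fun k hk => p'.2.2.1 (skip i k) ?_, ?_⟩, ?_⟩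
  · rw [hp, hp, p'.2.1]
  · rw [← hp, hk]
  · intro a b hab
    apply p'.2.2.2 (skip i a) (skip i b)
    simpa only [← hp, skip_lt_skip] using hab
  · exact (isInsertion_iff.1 ⟨h, fun j => (hp j).symm⟩).symm

/-! ### A row below an arc -/

/-- Unless the two columns below the arc at `i` carry `se`, `sw`, the lines pass below it. -/
theorem AddRow.congr_below_arc {m : ℕ} {i : Fin (m + 2)} {s s' : Fin (m + 2) → Tile}
    {p p' : LinkPattern (m + 2)} (hp : p.1 i = finRotate (m + 2) i)
    (hs : ¬ (s i = .se ∧ s (finRotate (m + 2) i) = .sw))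
    (hs' : ¬ (s' i = .se ∧ s' (finRotate (m + 2) i) = .sw))
    (hss : ∀ k, s (skip i k) = s' (skip i k))
    (h : AddRow s p p') : AddRow s' p p' := by
  have hp' : p.1 (finRotate (m + 2) i) = i := by rw [← hp, p.2.1]
  have hne := finRotate_ne i
  have hrr : finRotate (m + 2) (finRotate (m + 2) i) ≠ finRotate (m + 2) i := finRotate_ne _
  rw [addRow_iff] at h ⊢
  intro f hf
  -- For each of the three other pairs of tiles, the southern edge of column i is connected to the
  -- west of the two columns and that of the next column to their east, possibly by way of the arc
  -- above.
  have hw : f (.south i) ↔ f (.side i) := by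
    cases h1 : s' i with
    | sw => exact hf.south_west i h1
    | se =>
      have h2 : s' (finRotate (m + 2) i) = .se := by
        cases h2 : s' (finRotate (m + 2) i) <;> simp_all
      rw [hf.south_east i h1, ← hf.north_west i h1, ← hf.north_west _ h2, hf.pattern i, hp]
  have he : f (.south (finRotate (m + 2) i)) ↔
      f (.side (finRotate (m + 2) (finRotate (m + 2) i))) := by
    cases h2 : s' (finRotate (m + 2) i) with
    | se => exact hf.south_east _ h2
    | sw =>
      have h1 : s' i = .sw := by
        cases h1 : s' i <;> simp_all
      rw [hf.south_west _ h2, ← hf.north_east _ h2, ← hf.north_east _ h1, hf.pattern i, hp]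
  -- The colour of the edge between the two columns and of the arc above it. For `sw`, `sw` this
  -- line ends at the second southern edge and for `se`, `se` at the first; for `sw`, `se` it is a
  -- closed loop and any colour will do.
  let v : Prop := if s (finRotate (m + 2) i) = .sw then f (.south (finRotate (m + 2) i))
    else f (.south i)
  let g : Edge (m + 2) → Prop := fun e => match e with
    | .north k => if k = i ∨ k = finRotate (m + 2) i then v else f (.north k)
    | .south k => f (.south k)
    | .side k => if k = finRotate (m + 2) i then v else f (.side k)
  refine h g ⟨?_, ?_, ?_, ?_, ?_⟩
  · intro j
    induction j using skip_cases i with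
    | h1 => simp [g, hp, -finRotate_apply]
    | h2 => simp [g, hp', -finRotate_apply]
    | h3 k =>
      have h1 : p.1 (skip i k) ≠ i := fun hk =>
        skip_ne_finRotate i k (by rw [← p.2.1 (skip i k), hk, hp])
      have h2 : p.1 (skip i k) ≠ finRotate (m + 2) i := fun hk =>
        skip_ne i k (by rw [← p.2.1 (skip i k), hk, hp'])
      simp only [g, skip_ne, skip_ne_finRotate, h1, h2, or_self, if_false]
      exact hf.pattern _
  · intro j hj
    induction j using skip_cases i with
    | h1 => simpa only [g, hne.symm, if_false] using hw
    | h2 => simp only [g, v, hj, if_true]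
    | h3 k =>
      simp only [g, skip_ne_finRotate, if_false]
      exact hf.south_west _ (by rw [← hss, hj])
  · intro j hj
    induction j using skip_cases i with
    | h1 => simp only [g, true_or, if_true]
    | h2 => simpa only [g, v, hj, or_true, if_true, hrr, if_false] using he
    | h3 k =>
      have : finRotate (m + 2) (skip i k) ≠ finRotate (m + 2) i := by
        simpa only [ne_eq, EmbeddingLike.apply_eq_iff_eq] using skip_ne i k
      simp only [g, skip_ne_finRotate, skip_ne, this, or_self, if_false]
      exact hf.north_east _ (by rw [← hss, hj])
  · intro j hj
    induction j using skip_cases i with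
    | h1 =>
      have : s (finRotate (m + 2) i) ≠ .sw := fun h => hs ⟨hj, h⟩
      simp only [g, v, this, if_true, if_false]
    | h2 => simpa only [g, hrr, if_false] using he
    | h3 k =>
      have : finRotate (m + 2) (skip i k) ≠ finRotate (m + 2) i := by
        simpa only [ne_eq, EmbeddingLike.apply_eq_iff_eq] using skip_ne i k
      simp only [g, this, if_false]
      exact hf.south_east _ (by rw [← hss, hj])
  · intro j hj
    induction j using skip_cases i with
    | h1 =>
      have : s (finRotate (m + 2) i) ≠ .sw := fun h => hs ⟨hj, h⟩
      simpa only [g, v, this, hne.symm, true_or, if_true, if_false] using hw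
    | h2 => simp only [g, or_true, if_true]
    | h3 k =>
      simp only [g, skip_ne_finRotate, skip_ne, or_self, if_false]
      exact hf.north_west _ (by rw [← hss, hj])

/-- If the two columns below the arc at `i` carry `se`, `sw`, the arc is transported downwards. -/
theorem addRow_insertArc_iff {m : ℕ} {i : Fin (m + 2)} {s : Fin (m + 2) → Tile}
    {p p' : LinkPattern m} (hs : s i = .se) (hs' : s (finRotate (m + 2) i) = .sw) :
    AddRow s (insertArc i p) (insertArc i p') ↔ AddRow (fun k => s (skip i k)) p p' := by
  obtain ⟨hP, hPs⟩ := isInsertion_insertArc i p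
  obtain ⟨hQ, hQs⟩ := isInsertion_insertArc i p'
  have hP' := (isInsertion_insertArc i p).apply_finRotate
  have hQ' := (isInsertion_insertArc i p').apply_finRotate
  generalize insertArc i p = P at *
  generalize insertArc i p' = Q at *
  have hinj := fun {a b} => (skip_injective i).eq_iff (a := a) (b := b)
  rw [addRow_iff, addRow_iff]
  constructor
  · intro h f hf j
    -- The arc above, continued to the west and to the east, joins the two sides of the deleted
    -- columns. Its colour is that of the edge to the east; for m = 0 there is no such edge in the
    -- smaller row and the colour is false. The new arc below is also coloured false.
    let v : Prop := ∃ k, skip i k = finRotate (m + 2) (finRotate (m + 2) i) ∧ f (.side k)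
    let g : Edge (m + 2) → Prop := fun e => match e with
      | .north a => if a = i ∨ a = finRotate (m + 2) i then v else ∃ k, skip i k = a ∧ f (.north k)
      | .south a => ∃ k, skip i k = a ∧ f (.south k)
      | .side a => if a = i then v else ∃ k, skip i k = a ∧ f (.side k)
    have hgn : ∀ k, g (.north (skip i k)) ↔ f (.north k) := by
      intro k
      simp only [g, skip_ne, skip_ne_finRotate, or_self, if_false, hinj, exists_eq_left]
    have hgs : ∀ k, g (.south (skip i k)) ↔ f (.south k) := by
      intro k
      simp only [g, hinj, exists_eq_left]
    have hgw : ∀ k, g (.side (skip i k)) ↔ f (.side k) := by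
      intro k
      simp only [g, skip_ne, if_false, hinj, exists_eq_left]
    have hge : ∀ k, g (.side (finRotate (m + 2) (skip i k))) ↔ f (.side (finRotate m k)) := by
      intro k
      rcases finRotate_skip i k with h1 | ⟨h1, h2⟩
      · rw [h1, hgw]
      · rw [h1]
        simp only [g, v, if_true, ← h2, hinj, exists_eq_left]
    have hne := finRotate_ne i
    have key := h g ⟨?_, ?_, ?_, ?_, ?_⟩ (skip i j)
    · rwa [hQs, hgs, hgs] at key
    · intro j
      induction j using skip_cases i with
      | h1 => simp only [g, hP, or_true, true_or, if_true]
      | h2 => simp only [g, hP', or_true, true_or, if_true]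
      | h3 k => rw [hPs, hgn, hgn]; exact hf.pattern k
    · intro j hj
      induction j using skip_cases i with
      | h1 => simp [hs] at hj
      | h2 => simp only [g, skip_ne_finRotate, hne, if_false, false_and, exists_false]
      | h3 k => rw [hgs, hgw]; exact hf.south_west k hj
    · intro j hj
      induction j using skip_cases i with
      | h1 => simp [hs] at hj
      | h2 =>
        simp only [g, or_true, if_true]
        split_ifs <;> rfl
      | h3 k => rw [hgn, hge]; exact hf.north_east k hj
    · intro j hj
      induction j using skip_cases i with
      | h1 => simp only [g, skip_ne_finRotate, skip_ne, hne, if_false, false_and, exists_false]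
      | h2 => rw [hs'] at hj; cases hj
      | h3 k => rw [hgs, hge]; exact hf.south_east k hj
    · intro j hj
      induction j using skip_cases i with
      | h1 => simp only [g, true_or, if_true]
      | h2 => rw [hs'] at hj; cases hj
      | h3 k => rw [hgn, hgw]; exact hf.north_west k hj
  · intro h g hg j
    have hmid : g (.south i) ↔ g (.south (finRotate (m + 2) i)) := by
      rw [hg.south_east i hs, hg.south_west _ hs']
    have hge : ∀ k, g (.side (finRotate (m + 2) (skip i k))) ↔
        g (.side (skip i (finRotate m k))) := by
      intro k
      rcases finRotate_skip i k with h1 | ⟨h1, h2⟩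
      · rw [h1]
      · rw [h1, h2, ← hg.north_west i hs, ← hg.north_east _ hs', hg.pattern i, hP]
    induction j using skip_cases i with
    | h1 => rw [hQ, hmid]
    | h2 => rw [hQ', hmid]
    | h3 k =>
      rw [hQs]
      refine h (fun e => match e with
        | .north a => g (.north (skip i a))
        | .south a => g (.south (skip i a))
        | .side a => g (.side (skip i a))) ⟨?_, ?_, ?_, ?_, ?_⟩ k
      · intro a
        simpa only [hPs] using hg.pattern (skip i a)
      · exact fun a ha => hg.south_west _ ha
      · exact fun a ha => (hg.north_east _ ha).trans (hge a)
      · exact fun a ha => (hg.south_east _ ha).trans (hge a)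
      · exact fun a ha => hg.north_west _ ha

/-! ### Arithmetic of the cube root of unity -/

theorem q_eq : q = -1 / 2 + (√3 / 2 : ℝ) * Complex.I := by
  have h : (2 * Real.pi * Complex.I / 3 : ℂ) = ((Real.pi - Real.pi / 3 : ℝ) : ℂ) * Complex.I := by
    push_cast; ring
  rw [q, h, Complex.exp_mul_I, ← Complex.ofReal_cos, ← Complex.ofReal_sin, Real.cos_pi_sub,
    Real.sin_pi_sub, Real.cos_pi_div_three, Real.sin_pi_div_three]
  push_cast
  ring

theorem q_sq : q ^ 2 = -1 - q := by
  have h : ((√3 : ℝ) : ℂ) ^ 2 = 3 := by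
    rw [← Complex.ofReal_pow, Real.sq_sqrt (by norm_num)]
    norm_num
  rw [q_eq]
  push_cast
  linear_combination (Complex.I ^ 2 / 4) * h + (3 / 4) * Complex.I_sq

theorem q_cubed : q ^ 3 = 1 := by
  linear_combination (q - 1) * q_sq

theorem q_ne_zero : q ≠ 0 := Complex.exp_ne_zero _

theorem q_ne_one : q ≠ 1 := by
  intro h
  have := q_sq
  rw [h] at this
  norm_num at this

theorem q_sq_ne_one : q ^ 2 ≠ 1 := by
  intro h
  have := q_cubed
  rw [pow_succ, h, one_mul] at this
  exact q_ne_one this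

theorem sum_tile {M : Type*} [AddCommMonoid M] (f : Tile → M) : ∑ a, f a = f .sw + f .se := by
  have : (Finset.univ : Finset Tile) = {.sw, .se} := rfl
  rw [this, Finset.sum_pair (by simp)]

/-! ### Two columns below an arc -/

/-- The row with tiles `a`, `b` at `i` and its successor, and the tiles `s` elsewhere. -/
noncomputable def extendRow {m : ℕ} (i : Fin (m + 2)) (a b : Tile) (s : Fin m → Tile)
    (j : Fin (m + 2)) : Tile :=
  match (skipEquiv i).symm j with
  | none => a
  | some none => b
  | some (some k) => s k

section extendRow

variable {m : ℕ} (i : Fin (m + 2)) (a b : Tile) (s : Fin m → Tile)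

@[simp] theorem extendRow_self : extendRow i a b s i = a := by
  have : (skipEquiv i).symm i = none := by rw [Equiv.symm_apply_eq]; rfl
  simp only [extendRow, this]

theorem extendRow_finRotate : extendRow i a b s (finRotate (m + 2) i) = b := by
  have : (skipEquiv i).symm (finRotate (m + 2) i) = some none := by
    rw [Equiv.symm_apply_eq]; rfl
  simp only [extendRow, this]

@[simp] theorem extendRow_skip (k : Fin m) : extendRow i a b s (skip i k) = s k := by
  have : (skipEquiv i).symm (skip i k) = some (some k) := by rw [Equiv.symm_apply_eq]; rfl
  simp only [extendRow, this]

end extendRow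

theorem prod_eq_mul_prod_skip {M : Type*} [CommMonoid M] {m : ℕ} (i : Fin (m + 2))
    (f : Fin (m + 2) → M) :
    ∏ j, f j = f i * f (finRotate (m + 2) i) * ∏ k, f (skip i k) := by
  rw [← (skipEquiv i).prod_comp, Fintype.prod_option, Fintype.prod_option, mul_assoc]
  rfl

theorem sum_extendRow {M : Type*} [AddCommMonoid M] {m : ℕ} (i : Fin (m + 2))
    (F : (Fin (m + 2) → Tile) → M) :
    ∑ r, F r = ∑ s : Fin m → Tile, ∑ a, ∑ b, F (extendRow i a b s) := by
  have : ∑ r, F r = ∑ x : (Fin m → Tile) × Tile × Tile, F (extendRow i x.2.1 x.2.2 x.1) := by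
    symm
    refine Fintype.sum_bijective (fun x => extendRow i x.2.1 x.2.2 x.1) ⟨?_, ?_⟩ _ _ fun _ => rfl
    · rintro ⟨s, a, b⟩ ⟨s', a', b'⟩ h
      have h1 := congrFun h i
      have h2 := congrFun h (finRotate (m + 2) i)
      have h3 : s = s' := funext fun k => by simpa using congrFun h (skip i k)
      simp only [extendRow_self, extendRow_finRotate] at h1 h2
      rw [h1, h2, h3]
    · intro r
      refine ⟨(fun k => r (skip i k), r i, r (finRotate (m + 2) i)), ?_⟩
      funext j
      induction j using skip_cases i with
      | h1 => exact extendRow_self ..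
      | h2 => exact extendRow_finRotate ..
      | h3 k => exact extendRow_skip ..
  rw [this, Fintype.sum_prod_type]
  simp_rw [Fintype.sum_prod_type]

/-- Below an arc the connectivity sees two tiles only through whether they are `se`, `sw`; the pair
`sw`, `sw` represents all the others. -/
theorem addRow_extendRow_iff {m : ℕ} {i : Fin (m + 2)} {a b : Tile} {s : Fin m → Tile}
    {p p' : LinkPattern m} :
    AddRow (extendRow i a b s) (insertArc i p) (insertArc i p') ↔
      if a = .se ∧ b = .sw then AddRow s p p'
      else AddRow (extendRow i .sw .sw s) (insertArc i p) (insertArc i p') := by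
  split_ifs with h
  · rw [addRow_insertArc_iff (by simp [h.1]) (by rw [extendRow_finRotate, h.2])]
    simp only [extendRow_skip]
  · have hp := (isInsertion_insertArc i p).1
    have h1 : ¬(extendRow i a b s i = .se ∧ extendRow i a b s (finRotate (m + 2) i) = .sw) := by
      rwa [extendRow_self, extendRow_finRotate]
    have h2 : ¬(extendRow i .sw .sw s i = .se ∧
        extendRow i .sw .sw s (finRotate (m + 2) i) = .sw) := by
      simp
    constructor
    · exact AddRow.congr_below_arc hp h1 h2 (by simp)
    · exact AddRow.congr_below_arc hp h2 h1 (by simp)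

/-- At w = 1 this total is q - z², the factor that turns the weights in `regime` into probabilities.
-/
theorem sum_faceWeight (z w : ℂ) :
    ∑ a, ∑ b, faceWeight z w a b = q * w ^ 2 - z ^ 2 := by
  simp only [sum_tile, faceWeight, omegaD, omegaA, omegaR, omegaL]
  have h3 := q_cubed
  linear_combination (w * z - z^2 + w^2 - w * z) * q_sq - w * z * h3

open Classical in
/-- The two columns below an arc act by a scalar when their parameters are `z` and `-q² z`. -/
theorem sum_faceWeight_pair (z t : ℂ) (X Y X' Y' : Prop) :
    (∑ a, ∑ b, ∑ a', ∑ b', if (if a = Tile.se ∧ b = Tile.sw then X else X') ∧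
        (if a' = Tile.se ∧ b' = Tile.sw then Y else Y') then
        faceWeight z t a a' * faceWeight (-q ^ 2 * z) t b b' else 0) =
      if X ∧ Y then (q * t ^ 2 - z ^ 2) * (q * t ^ 2 - (-q ^ 2 * z) ^ 2) else 0 := by
  simp only [sum_tile, faceWeight, omegaD, omegaA, omegaR, omegaL]
  by_cases hX : X <;> by_cases hX' : X' <;> by_cases hY : Y <;> by_cases hY' : Y' <;>
    simp [hX, hX', hY, hY']
  -- Each remaining case is a polynomial identity modulo q² + q + 1; the terms with X' or Y' cancel.
  all_goals
    have h := q_sq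
    generalize q = q at h
    grind

/-- For fixed tiles in the other columns, connectivity depends on the two columns below the arcs
only through the dichotomy of `addRow_extendRow_iff`, so their weights sum to the scalar of
`sum_faceWeight_pair`. -/
theorem transferMatrix_insertArc {m : ℕ} (i : Fin (m + 2)) (t : ℂ) (z : Fin (m + 2) → ℂ)
    (hz : z (finRotate (m + 2) i) = -q ^ 2 * z i) (ρ' ρ : Configuration m) :
    transferMatrix t z (insertArc i ρ'.1, insertArc i ρ'.2) (insertArc i ρ.1, insertArc i ρ.2) =
      (q * t ^ 2 - z i ^ 2) * (q * t ^ 2 - z (finRotate (m + 2) i) ^ 2) *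
        transferMatrix t (fun k => z (skip i k)) ρ' ρ := by
  classical
  simp only [transferMatrix, Matrix.of_apply]
  rw [sum_extendRow i, Finset.mul_sum]
  refine Finset.sum_congr rfl fun r _ => ?_
  simp_rw [sum_extendRow i (M := ℂ)]
  rw [Finset.mul_sum]
  let W (s : Fin m → Tile) (a b a' b' : Tile) : ℂ :=
    if (if a = .se ∧ b = .sw then AddRow r ρ.1 ρ'.1
        else AddRow (extendRow i .sw .sw r) (insertArc i ρ.1) (insertArc i ρ'.1)) ∧
      (if a' = .se ∧ b' = .sw then AddRow s ρ.2 ρ'.2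
        else AddRow (extendRow i .sw .sw s) (insertArc i ρ.2) (insertArc i ρ'.2)) then
      faceWeight (z i) t a a' * faceWeight (-q ^ 2 * z i) t b b' else 0
  have hW : ∀ a b, (∑ s : Fin m → Tile, ∑ a', ∑ b', if
      AddRow (extendRow i a b r) (insertArc i ρ.1) (insertArc i ρ'.1) ∧
      AddRow (extendRow i a' b' s) (insertArc i ρ.2) (insertArc i ρ'.2) then
      ∏ j, faceWeight (z j) t (extendRow i a b r j) (extendRow i a' b' s j) else 0) =
      ∑ s : Fin m → Tile, ∑ a', ∑ b', W s a b a' b' *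
        ∏ k, faceWeight (z (skip i k)) t (r k) (s k) := by
    intro a b
    refine Finset.sum_congr rfl fun s _ => Finset.sum_congr rfl fun a' _ =>
      Finset.sum_congr rfl fun b' _ => ?_
    rw [addRow_extendRow_iff (a := a), addRow_extendRow_iff (a := a'), prod_eq_mul_prod_skip i]
    simp only [W, extendRow_self, extendRow_finRotate, extendRow_skip, hz, ite_mul, zero_mul]
  have hcomm : ∀ a, (∑ b, ∑ s : Fin m → Tile, ∑ a', ∑ b', W s a b a' b' *
        ∏ k, faceWeight (z (skip i k)) t (r k) (s k)) =
      ∑ s : Fin m → Tile, (∑ b, ∑ a', ∑ b', W s a b a' b') *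
        ∏ k, faceWeight (z (skip i k)) t (r k) (s k) := by
    intro a
    rw [Finset.sum_comm]
    simp only [Finset.sum_mul]
  simp_rw [hW, hcomm]
  rw [Finset.sum_comm]
  refine Finset.sum_congr rfl fun s _ => ?_
  rw [← Finset.sum_mul, sum_faceWeight_pair, hz]
  split_ifs <;> simp

/-! ### Uniqueness of eigenvectors in the regime of positive weights -/

/-- An eigenvector, for the eigenvalue `1`, of a substochastic matrix with a positive row vanishes
if its component on this row does. -/
theorem eq_zero_of_substochastic {ι : Type*} [Fintype ι] (M : Matrix ι ι ℝ)
    (h0 : ∀ i j, 0 ≤ M i j) (h1 : ∀ j, ∑ i, M i j ≤ 1) (k : ι) (hk : ∀ j, 0 < M k j) (u : ι → ℂ)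
    (hu : ∀ i, ∑ j, (M i j : ℂ) * u j = u i) (huk : u k = 0) : u = 0 := by
  have hle : ∀ i ∈ Finset.univ, ‖u i‖ ≤ ∑ j, M i j * ‖u j‖ := by
    intro i _
    rw [← hu i]
    refine (norm_sum_le _ _).trans (Finset.sum_le_sum fun j _ => ?_)
    rw [norm_mul, Complex.norm_real, Real.norm_of_nonneg (h0 i j)]
  -- Summing the triangle inequalities over i gives the reverse inequality, so each one is an
  -- equality. On row k this forces all the terms to vanish.
  have hsum : ∑ i, ∑ j, M i j * ‖u j‖ ≤ ∑ i, ‖u i‖ := by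
    rw [Finset.sum_comm]
    refine Finset.sum_le_sum fun j _ => ?_
    rw [← Finset.sum_mul]
    exact mul_le_of_le_one_left (norm_nonneg _) (h1 j)
  have heq := (Finset.sum_eq_sum_iff_of_le hle).1 (le_antisymm (Finset.sum_le_sum hle) hsum) k
    (Finset.mem_univ k)
  rw [huk, norm_zero, eq_comm, Finset.sum_eq_zero_iff_of_nonneg
    fun j _ => mul_nonneg (h0 k j) (norm_nonneg _)] at heq
  funext j
  have := heq j (Finset.mem_univ j)
  rw [mul_eq_zero, norm_eq_zero] at this
  exact this.resolve_left (hk j).ne'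

/-- Parameters for which all the weights `faceWeight z 1` are positive up to a common factor. -/
def regime : Set ℂ :=
  {z | (∃ a : Tile → Tile → ℝ, (∀ x y, 0 < a x y) ∧
    ∀ x y, faceWeight z 1 x y = (q - z ^ 2) * a x y) ∧ z ^ 2 ≠ 1 ∧ ‖z ^ 2 - 1‖ < 1 / 4}

theorem one_lt_norm_q_sub_one : 1 < ‖q - 1‖ := by
  have h : q - 1 = ((-3 / 2 : ℝ) : ℂ) + ((√3 / 2 : ℝ) : ℂ) * Complex.I := by
    rw [q_eq]; push_cast; ring
  rw [h, Complex.norm_add_mul_I]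
  apply Real.lt_sqrt_of_sq_lt
  nlinarith [sq_nonneg (√3 / 2)]

/-- Both squares lie within 1/4 of 1, so equality would put q within 1/2 of 1, whereas |q - 1| > 1.
-/
theorem ne_q_mul_of_mem_regime {z w : ℂ} (hz : z ∈ regime) (hw : w ∈ regime) :
    z ^ 2 ≠ q * w ^ 2 := by
  intro h
  have h1 : q - 1 = (z ^ 2 - 1) - q * (w ^ 2 - 1) := by linear_combination -h
  have h2 : ‖q‖ = 1 := by
    have := congrArg norm q_cubed
    rw [norm_pow, norm_one] at this
    exact (pow_eq_one_iff_of_nonneg (norm_nonneg _) (by norm_num)).1 this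
  have h3 := norm_sub_le (z ^ 2 - 1) (q * (w ^ 2 - 1))
  rw [← h1, norm_mul, h2, one_mul] at h3
  linarith [one_lt_norm_q_sub_one, hz.2.2, hw.2.2]

theorem sub_ne_zero_of_mem_regime {z : ℂ} (hz : z ∈ regime) : q - z ^ 2 ≠ 0 := by
  intro h
  have := hz.2.2
  rw [← sub_eq_zero.1 h] at this
  linarith [one_lt_norm_q_sub_one]

theorem ne_zero_of_mem_regime {z : ℂ} (hz : z ∈ regime) : z ≠ 0 := by
  rintro rfl
  have := hz.2.2
  norm_num at this

/-- These are points of the unit circle near 1, where all four weights are positive multiples of q -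
z². Positivity needs s < 1/√3; the bound 1/16 serves |z² - 1| = 4s/(1 + s²) < 1/4. -/
theorem cayley_mem_regime {s : ℝ} (h0 : 0 < s) (h1 : s < 1 / 16) :
    (1 - s * Complex.I) / (1 + s * Complex.I) ∈ regime := by
  have hI := Complex.I_sq
  have hne : (1 + s * Complex.I : ℂ) ≠ 0 := by
    intro h
    have := congrArg Complex.re h
    simp at this
  have h3 : (√3 : ℝ) ^ 2 = 3 := Real.sq_sqrt (by norm_num)
  have h3' : ((√3 : ℝ) : ℂ) ^ 2 = 3 := by exact_mod_cast h3
  have hr0 : 0 < √3 := Real.sqrt_pos.2 (by norm_num)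
  have hr1 : 1 < √3 := by nlinarith
  have hr2 : √3 < 2 := by nlinarith
  have hA : 0 < 1 + √3 * s := by positivity
  have hB : 0 < √3 - s := by linarith
  have hC : 0 < 1 - √3 * s := by nlinarith
  have hsub : ((1 - s * Complex.I) / (1 + s * Complex.I)) ^ 2 - 1 =
      -(4 * s * Complex.I) / (1 + s * Complex.I) ^ 2 := by
    field_simp
    ring
  refine ⟨⟨fun x y => match x, y with
    | .sw, .sw => (1 - √3 * s) / (1 + √3 * s)
    | .se, .se => 2 * s / (√3 - s)
    | .sw, .se => 2 * s * (1 - √3 * s) / ((√3 - s) * (1 + √3 * s))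
    | .se, .sw => 2 * s * (1 - √3 * s) / ((√3 - s) * (1 + √3 * s)), ?_, ?_⟩, ?_, ?_⟩
  · rintro (_ | _) (_ | _) <;> simp only <;> positivity
  · have hA' : (1 + (√3 : ℝ) * s : ℂ) ≠ 0 := by exact_mod_cast hA.ne'
    have hA'' : (1 + s * (√3 : ℝ) : ℂ) ≠ 0 := by rwa [mul_comm (s : ℂ)]
    have hB' : ((√3 : ℝ) - s : ℂ) ≠ 0 := by exact_mod_cast hB.ne'
    rintro (_ | _) (_ | _) <;> simp only [faceWeight, omegaD, omegaA, omegaR, omegaL] <;>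
      push_cast <;> field_simp <;> rw [q_eq] <;> push_cast <;> field_simp <;>
      generalize ((√3 : ℝ) : ℂ) = r at * <;> generalize Complex.I = I at * <;>
      generalize (s : ℂ) = x at * <;> clear * - hI h3' <;> grind
  · rw [ne_eq, ← sub_eq_zero, hsub]
    simp [hne, h0.ne']
  · rw [hsub, norm_div, norm_neg, norm_pow]
    have h4 : ‖(4 * s * Complex.I : ℂ)‖ = 4 * s := by
      simp [abs_of_pos h0]
    have h5 : ‖(1 + s * Complex.I : ℂ)‖ ^ 2 = 1 + s ^ 2 := by
      have := Complex.norm_add_mul_I 1 s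
      rw [Complex.ofReal_one] at this
      rw [this, Real.sq_sqrt (by positivity)]
      ring
    rw [h4, h5, div_lt_iff₀ (by positivity)]
    nlinarith

theorem regime_infinite : regime.Infinite := by
  have hinj : Set.InjOn (fun s : ℝ => ((1 - s * Complex.I) / (1 + s * Complex.I) : ℂ))
      (Set.Ioo 0 (1 / 16)) := by
    intro s _ t _ h
    have hne : ∀ s : ℝ, (1 + s * Complex.I : ℂ) ≠ 0 := by
      intro s h
      have := congrArg Complex.re h
      simp at this
    simp only at h
    rw [div_eq_div_iff (hne s) (hne t)] at h
    have : (2 * Complex.I) * (s - t) = 0 := by linear_combination -h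
    rw [mul_eq_zero, sub_eq_zero] at this
    exact_mod_cast this.resolve_left (by simp)
  refine ((Set.Ioo_infinite (by norm_num)).image hinj).mono ?_
  rintro _ ⟨s, hs, rfl⟩
  exact cayley_mem_regime hs.1 hs.2

/-- The link pattern joining `2k` and `2k + 1` for all `k`. -/
def smallArcs (n : ℕ) : LinkPattern (2 * n) :=
  ⟨fun j => if h : (j : ℕ) % 2 = 0 then ⟨j + 1, by omega⟩ else ⟨j - 1, by omega⟩, by
    intro i
    have h1 : (i : ℕ) % 2 = 0 → ¬ ((i : ℕ) + 1) % 2 = 0 := by omega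
    have h2 : ¬ (i : ℕ) % 2 = 0 → ((i : ℕ) - 1) % 2 = 0 := by omega
    by_cases h : (i : ℕ) % 2 = 0
    · simp [h, h1 h]
    · simp only [h, h2 h, dif_neg, dif_pos, not_false_eq_true, Fin.ext_iff]
      omega, by
    intro i h
    rw [Fin.ext_iff] at h
    dsimp only at h
    split_ifs at h <;> simp only at h <;> omega, by
    intro i j h
    simp only [Fin.lt_def] at h
    split_ifs at h <;> simp only at h <;> omega⟩

/-- The row that creates the pattern `smallArcs`. -/
def smallArcsRow (n : ℕ) (j : Fin (2 * n)) : Tile := if (j : ℕ) % 2 = 0 then .se else .sw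

theorem addRow_smallArcs (n : ℕ) (p : LinkPattern (2 * n)) :
    AddRow (smallArcsRow n) p (smallArcs n) := by
  rw [addRow_iff]
  intro f hf
  have key : ∀ j : Fin (2 * n), (j : ℕ) % 2 = 0 →
      (f (.south j) ↔ f (.south (finRotate (2 * n) j))) := by
    intro j hj
    have h1 := val_finRotate j
    rw [if_neg (by omega)] at h1
    rw [hf.south_east j (by simp [smallArcsRow, hj]),
      hf.south_west _ (by rw [smallArcsRow, if_neg (by omega)])]
  intro j
  by_cases hj : (j : ℕ) % 2 = 0
  · rw [key j hj]
    have : finRotate (2 * n) j = (smallArcs n).1 j := by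
      rw [Fin.ext_iff, val_finRotate, if_neg (by omega)]
      simp [smallArcs, hj]
    rw [this]
  · have h2 : ((smallArcs n).1 j : ℕ) = j - 1 := by simp [smallArcs, hj]
    rw [key ((smallArcs n).1 j) (by omega)]
    have : finRotate (2 * n) ((smallArcs n).1 j) = j := by
      rw [Fin.ext_iff, val_finRotate, if_neg (by omega)]
      omega
    rw [this]

/-- In the regime of positive weights an eigenvector that vanishes on the configuration of small
arcs is zero. -/
theorem eq_zero_of_smallArcs {n : ℕ} {z : Fin (2 * n) → ℂ} (hz : ∀ j, z j ∈ regime)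
    {u : Configuration (2 * n) → ℂ}
    (hu : (transferMatrix 1 z).mulVec u = (∏ j, (q - z j ^ 2)) • u)
    (h0 : u (smallArcs n, smallArcs n) = 0) : u = 0 := by
  classical
  choose a ha hw using fun j => (hz j).1
  have hΛ : ∏ j, (q - z j ^ 2) ≠ 0 :=
    Finset.prod_ne_zero_iff.2 fun j _ => sub_ne_zero_of_mem_regime (hz j)
  let M : Matrix (Configuration (2 * n)) (Configuration (2 * n)) ℝ :=
    Matrix.of fun π' π => ∑ r : Fin (2 * n) → Tile, ∑ g : Fin (2 * n) → Tile,
      if AddRow r π.1 π'.1 ∧ AddRow g π.2 π'.2 then ∏ j, a j (r j) (g j) else 0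
  have hpos : ∀ r g : Fin (2 * n) → Tile, 0 < ∏ j, a j (r j) (g j) :=
    fun r g => Finset.prod_pos fun j _ => ha j _ _
  have hTM : ∀ π' π, transferMatrix 1 z π' π = (∏ j, (q - z j ^ 2)) * (M π' π : ℂ) := by
    intro π' π
    simp only [transferMatrix, M, Matrix.of_apply, Complex.ofReal_sum, Finset.mul_sum]
    refine Finset.sum_congr rfl fun r _ => Finset.sum_congr rfl fun g _ => ?_
    split_ifs
    · rw [Complex.ofReal_prod, ← Finset.prod_mul_distrib]
      exact Finset.prod_congr rfl fun j _ => hw j _ _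
    · simp
  have hterm : ∀ (r g : Fin (2 * n) → Tile) (π' π : Configuration (2 * n)),
      0 ≤ if AddRow r π.1 π'.1 ∧ AddRow g π.2 π'.2 then
      ∏ j, a j (r j) (g j) else 0 := by
    intro r g π' π
    split_ifs
    exacts [(hpos r g).le, le_rfl]
  refine eq_zero_of_substochastic M ?_ ?_ (smallArcs n, smallArcs n) ?_ u ?_ h0
  · intro π' π
    exact Finset.sum_nonneg fun r _ => Finset.sum_nonneg fun g _ => hterm r g π' π
  · intro π
    have hsum : ∀ j, ∑ x, ∑ y, a j x y = 1 := by
      intro j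
      have h := sum_faceWeight (z j) 1
      simp_rw [hw, ← Finset.mul_sum] at h
      rw [one_pow, mul_one] at h
      exact_mod_cast mul_left_cancel₀ (sub_ne_zero_of_mem_regime (hz j)) (h.trans (mul_one _).symm)
    calc ∑ π', M π' π = ∑ r : Fin (2 * n) → Tile, ∑ g : Fin (2 * n) → Tile,
          ∑ π' : Configuration (2 * n),
          if AddRow r π.1 π'.1 ∧ AddRow g π.2 π'.2 then ∏ j, a j (r j) (g j) else 0 := by
            simp only [M, Matrix.of_apply]
            rw [Finset.sum_comm]
            exact Finset.sum_congr rfl fun r _ => Finset.sum_comm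
      _ ≤ ∑ r : Fin (2 * n) → Tile, ∑ g : Fin (2 * n) → Tile, ∏ j, a j (r j) (g j) := by
            refine Finset.sum_le_sum fun r _ => Finset.sum_le_sum fun g _ => ?_
            -- By `AddRow.unique` a pair of rows leads to at most one configuration. That it leads
            -- to one is not needed, since an inequality suffices.
            rw [← Finset.sum_filter, Finset.sum_const, nsmul_eq_mul]
            refine mul_le_of_le_one_left (hpos r g).le ?_
            rw [Nat.cast_le_one, Finset.card_le_one]
            intro π₁ h₁ π₂ h₂
            rw [Finset.mem_filter] at h₁ h₂
            exact Prod.ext (h₁.2.1.unique h₂.2.1) (h₁.2.2.unique h₂.2.2)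
      _ = ∏ j, ∑ x : Tile × Tile, a j x.1 x.2 := by
            rw [Fintype.prod_sum, ← Fintype.sum_prod_type']
            exact Fintype.sum_equiv (Equiv.arrowProdEquivProdArrow _ _ _).symm _ _ fun _ => rfl
      _ = 1 := Finset.prod_eq_one fun j _ => by rw [Fintype.sum_prod_type, hsum]
      _ ≤ 1 := le_rfl
  · intro π
    refine Finset.sum_pos' (fun r _ => Finset.sum_nonneg fun g _ => hterm r g _ π)
      ⟨smallArcsRow n, Finset.mem_univ _, Finset.sum_pos' (fun g _ => hterm _ g _ π)
      ⟨smallArcsRow n, Finset.mem_univ _, ?_⟩⟩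
    rw [if_pos ⟨addRow_smallArcs n _, addRow_smallArcs n _⟩]
    exact hpos _ _
  · intro π'
    have h := congrFun hu π'
    simp only [Matrix.mulVec, dotProduct, hTM, Pi.smul_apply, smul_eq_mul, mul_assoc] at h
    rw [← Finset.mul_sum] at h
    exact mul_left_cancel₀ hΛ h

/-! ### Rotations of the maximally nested link pattern -/

/-- The rotation of a link pattern by one step. -/
def rotate {N : ℕ} (p : LinkPattern N) : LinkPattern N :=
  ⟨fun j => finRotate N (p.1 ((finRotate N).symm j)), by
    intro i
    dsimp only
    rw [Equiv.symm_apply_apply, p.2.1, Equiv.apply_symm_apply], by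
    intro i h
    rw [← Equiv.eq_symm_apply] at h
    exact p.2.2.1 _ h, by
    intro i j
    obtain ⟨a, rfl⟩ := (finRotate N).surjective i
    obtain ⟨b, rfl⟩ := (finRotate N).surjective j
    simp only [Equiv.symm_apply_apply]
    rintro ⟨h1, h2, h3⟩
    -- A rotated crossing comes from a crossing that starts at a, or at b when a is the last point,
    -- which the rotation carries to 0.
    have ha := p.2.2.2 a b
    have hb := p.2.2.2 b (p.1 a)
    rw [p.2.1] at hb
    have va := val_finRotate a
    have vb := val_finRotate b
    have vpa := val_finRotate (p.1 a)
    have vpb := val_finRotate (p.1 b)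
    have := a.2
    have := b.2
    have := (p.1 a).2
    have := (p.1 b).2
    rw [Fin.lt_def] at h1 h2 h3
    simp only [Fin.lt_def] at ha hb
    split_ifs at va vb vpa vpb <;> omega⟩

theorem rotate_apply_finRotate {N : ℕ} (p : LinkPattern N) (j : Fin N) :
    (rotate p).1 (finRotate N j) = finRotate N (p.1 j) := by
  simp only [rotate, Equiv.symm_apply_apply]

/-- The maximally nested link pattern rotated by `k` steps. -/
def rotatedNested (n k : ℕ) : LinkPattern (2 * n) := rotate^[k] (nested n)

theorem rotatedNested_apply (n k : ℕ) (x : Fin (2 * n)) :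
    (rotatedNested n k).1 ((finRotate (2 * n) ^ k) x) = (finRotate (2 * n) ^ k) x.rev := by
  induction k with
  | zero => rfl
  | succ k ih =>
    rw [rotatedNested, Function.iterate_succ_apply', pow_succ', Equiv.Perm.mul_apply,
      rotate_apply_finRotate, Equiv.Perm.mul_apply]
    rw [rotatedNested] at ih
    rw [ih]

theorem addRow_sw_rotate_iff {N : ℕ} {p p' : LinkPattern N} :
    AddRow (fun _ => .sw) p' (rotate p) ↔ p' = p := by
  rw [addRow_sw_iff]
  constructor
  · intro h
    apply Subtype.ext
    funext j
    have := h j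
    rw [rotate_apply_finRotate] at this
    exact ((finRotate N).injective this).symm
  · rintro rfl j
    rw [rotate_apply_finRotate]

theorem finRotate_pow_val {N : ℕ} (k : ℕ) (x : Fin N) :
    ((finRotate N ^ k) x : ℕ) = (x + k) % N := by
  induction k with
  | zero => simp [Nat.mod_eq_of_lt]
  | succ k ih =>
    rw [pow_succ', Equiv.Perm.mul_apply, val_finRotate, ih]
    have h0 : 0 < N := x.pos
    have h1 := Nat.mod_lt (x + k : ℕ) h0
    rw [← add_assoc, Nat.add_mod_eq_ite (m := x + k) (n := 1)]
    by_cases hN : N = 1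
    · subst hN
      simp [Nat.mod_one]
    · rw [Nat.mod_eq_of_lt (show 1 < N by omega)]
      split_ifs <;> omega

/-- No row creates a maximally nested pattern if, within one of its halves, it has a tile `se`
before a tile `sw`. -/
theorem not_addRow_rotatedNested {n k : ℕ} {s : Fin (2 * n) → Tile} {p : LinkPattern (2 * n)}
    {x y : ℕ} (hxy : x < y) (hx : x < 2 * n) (hy : y < 2 * n) (hhalf : n ≤ x ∨ y < n)
    (hsx : s ((finRotate (2 * n) ^ k) ⟨x, hx⟩) = .se)
    (hsy : s ((finRotate (2 * n) ^ k) ⟨y, hy⟩) = .sw) : ¬ AddRow s p (rotatedNested n k) := by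
  intro h
  -- Somewhere between x and y a tile `se` is directly followed by `sw`, which creates a small arc.
  -- Within a half the nested pattern has none: its innermost arc joins n - 1 and n.
  have hstep : ∃ v, ∃ hv : v + 1 < 2 * n, x ≤ v ∧ v < y ∧
      s ((finRotate (2 * n) ^ k) ⟨v, by omega⟩) = .se ∧
      s ((finRotate (2 * n) ^ k) ⟨v + 1, hv⟩) = .sw := by
    clear h hhalf
    induction y, hxy using Nat.le_induction with
    | base => exact ⟨x, hy, le_rfl, Nat.lt_succ_self x, hsx, hsy⟩
    | succ y hxy ih =>
      cases hs : s ((finRotate (2 * n) ^ k) ⟨y, by omega⟩) with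
      | sw =>
        obtain ⟨v, hv, h1, h2, h3⟩ := ih (by omega) hs
        exact ⟨v, hv, h1, by omega, h3⟩
      | se => exact ⟨y, hy, by omega, by omega, hs, hsy⟩
  obtain ⟨v, hv, h1, h2, h3, h4⟩ := hstep
  have hr : finRotate (2 * n) ((finRotate (2 * n) ^ k) ⟨v, by omega⟩) =
      (finRotate (2 * n) ^ k) ⟨v + 1, hv⟩ := by
    rw [← Equiv.Perm.mul_apply, ← pow_succ', pow_succ, Equiv.Perm.mul_apply]
    congr 1
    rw [Fin.ext_iff, val_finRotate, if_neg (by simp only; omega)]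
  have := h.small_arc h3 (by rw [hr, h4])
  rw [hr, rotatedNested_apply, EmbeddingLike.apply_eq_iff_eq, Fin.ext_iff, Fin.val_rev] at this
  simp only at this
  omega

/-- The inserted arc becomes the innermost or outermost arc of a rotated nested pattern. -/
theorem skip_finRotate_pow {m : ℕ} (i : Fin (m + 2)) (y : Fin m) :
    skip i ((finRotate m ^ min (i : ℕ) m) y) =
      (finRotate (m + 2) ^ ((i : ℕ) + 1)) ⟨y + 1, by omega⟩ := by
  have hy := y.2
  have hi := i.2
  rw [Fin.ext_iff, val_skip, finRotate_pow_val, finRotate_pow_val]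
  simp only
  have e1 : ((y : ℕ) + min (i : ℕ) m) % m =
      if m ≤ (y : ℕ) + min (i : ℕ) m then (y : ℕ) + min (i : ℕ) m - m
      else (y : ℕ) + min (i : ℕ) m := by
    split_ifs with h
    · rw [Nat.mod_eq_sub_mod h, Nat.mod_eq_of_lt (by omega)]
    · rw [Nat.mod_eq_of_lt (by omega)]
  have e2 : ((y : ℕ) + 1 + ((i : ℕ) + 1)) % (m + 2) =
      if m + 2 ≤ (y : ℕ) + i + 2 then (y : ℕ) + i - m else (y : ℕ) + i + 2 := by
    split_ifs with h
    · rw [Nat.mod_eq_sub_mod (by omega), Nat.mod_eq_of_lt (by omega)]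
      omega
    · rw [Nat.mod_eq_of_lt (by omega)]
      omega
  rw [e1, e2]
  -- The minimum matters at i = m + 1: there `skip` starts at the point 1, and the smaller pattern
  -- is rotated as for i = m, a full turn.
  rcases le_total (i : ℕ) m with h | h
  · rw [min_eq_left h]
    split_ifs <;> omega
  · rw [min_eq_right h]
    split_ifs <;> omega

theorem finRotate_pow_last {m : ℕ} (i : Fin (m + 2)) :
    (finRotate (m + 2) ^ ((i : ℕ) + 1)) (Fin.last (m + 1)) = i := by
  rw [Fin.ext_iff, finRotate_pow_val, Fin.val_last]
  have : m + 1 + ((i : ℕ) + 1) = i + (m + 2) := by omega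
  rw [this, Nat.add_mod_right, Nat.mod_eq_of_lt i.2]

theorem finRotate_pow_zero {m : ℕ} (i : Fin (m + 2)) :
    (finRotate (m + 2) ^ ((i : ℕ) + 1)) 0 = finRotate (m + 2) i := by
  conv_rhs => rw [← finRotate_pow_last i]
  rw [← Equiv.Perm.mul_apply, ← pow_succ', pow_succ _ ((i : ℕ) + 1), Equiv.Perm.mul_apply,
    finRotate_last]

/-- Rotation by i + 1 carries the outermost arc, which joins the last point and 0, to i and its
successor. This is the red pattern that fixes the constant in the recursion. -/
theorem insertArc_rotatedNested (n : ℕ) (i : Fin (2 * n + 2)) :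
    insertArc i (rotatedNested n (min (i : ℕ) (2 * n))) = rotatedNested (n + 1) (i + 1) := by
  symm
  rw [← isInsertion_iff]
  constructor
  · have h := rotatedNested_apply (n + 1) (i + 1) (Fin.last (2 * n + 1))
    have h1 := finRotate_pow_last i
    have h2 := finRotate_pow_zero i
    have h3 : (Fin.last (2 * n + 1)).rev = 0 := Fin.rev_last _
    have h4 : (rotatedNested (n + 1) (i + 1)).1
      ((finRotate (2 * n + 2) ^ ((i : ℕ) + 1)) (Fin.last (2 * n + 1))) =
      (finRotate (2 * n + 2) ^ ((i : ℕ) + 1)) (Fin.last (2 * n + 1)).rev := h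
    rwa [h3, h1, h2] at h4
  · intro j
    obtain ⟨y, rfl⟩ := (finRotate (2 * n) ^ min (i : ℕ) (2 * n)).surjective j
    have h1 := skip_finRotate_pow i y
    have h2 := skip_finRotate_pow i y.rev
    rw [rotatedNested_apply, h1, h2]
    refine (rotatedNested_apply (n + 1) (i + 1) _).trans ?_
    congr 1
    rw [Fin.ext_iff, Fin.val_rev]
    simp only [Fin.val_rev]
    omega

open MvPolynomial

/-! ### Linear factors of polynomials -/

/-- The linear form `z_b - q z_a`. -/
noncomputable def linearForm {σ : Type*} (a b : σ) : MvPolynomial σ ℂ := X b - C q * X a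

open Classical in
/-- The substitution `z_b = c z_a`. -/
noncomputable def substitute {σ : Type*} (c : ℂ) (a b : σ) :
    MvPolynomial σ ℂ →ₐ[ℂ] MvPolynomial σ ℂ :=
  bind₁ fun j => if j = b then C c * X a else X j

theorem eval_substitute {σ : Type*} [DecidableEq σ] (c : ℂ) (a b : σ) (z : σ → ℂ)
    (P : MvPolynomial σ ℂ) :
    eval z (substitute c a b P) = eval (Function.update z b (c * z a)) P := by
  rw [substitute, eval, eval₂Hom_bind₁]
  congr 2
  funext j
  by_cases h : j = b
  · subst h
    simp
  · simp [h]

/-- Modulo the linear form the substitution is the identity. -/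
theorem linearForm_dvd_of_substitute_eq_zero {σ : Type*} {a b : σ} {P : MvPolynomial σ ℂ}
    (h : substitute q a b P = 0) : linearForm a b ∣ P := by
  classical
  let I := Ideal.span {linearForm a b}
  have hhom : (Ideal.Quotient.mkₐ ℂ I).comp (substitute q a b) = Ideal.Quotient.mkₐ ℂ I := by
    apply algHom_ext
    intro j
    simp only [AlgHom.comp_apply, substitute, bind₁_X_right, Ideal.Quotient.mkₐ_eq_mk]
    split_ifs with hj
    · subst hj
      rw [Ideal.Quotient.eq, ← neg_mem_iff, Ideal.mem_span_singleton, neg_sub]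
      exact dvd_rfl
    · rfl
  have := congrArg (fun f => f P) hhom
  simp only [AlgHom.comp_apply, h, map_zero] at this
  rw [← Ideal.mem_span_singleton]
  exact Ideal.Quotient.eq_zero_iff_mem.1 this.symm

theorem substitute_linearForm {σ : Type*} {a b : σ} (hab : a ≠ b) :
    substitute q a b (linearForm a b) = 0 := by
  simp [substitute, linearForm, hab]

theorem linearForm_ne_zero {σ : Type*} {a b : σ} (hab : a ≠ b) : linearForm a b ≠ 0 := by
  classical
  intro h
  have := congrArg (eval (Pi.single b 1)) h
  simp [linearForm, hab] at this

/-- The linear form generates the kernel of a substitution with values in a domain. -/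
theorem prime_linearForm {σ : Type*} {a b : σ} (hab : a ≠ b) : Prime (linearForm a b) := by
  rw [← Ideal.span_singleton_prime (linearForm_ne_zero hab)]
  have : Ideal.span {linearForm a b} = RingHom.ker (substitute q a b) := by
    apply le_antisymm
    · rw [Ideal.span_singleton_le_iff_mem]
      exact substitute_linearForm hab
    · intro P hP
      exact Ideal.mem_span_singleton.2 (linearForm_dvd_of_substitute_eq_zero hP)
  rw [this]
  exact RingHom.ker_isPrime _

theorem isRelPrime_linearForm {σ : Type*} {a b a' b' : σ} (hab : a ≠ b) (hab' : a' ≠ b')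
    (h : a = a' → b ≠ b') : IsRelPrime (linearForm a b) (linearForm a' b') := by
  classical
  rw [(prime_linearForm hab).irreducible.isRelPrime_iff_not_dvd]
  rintro ⟨Q, hQ⟩
  have hS := congrArg (substitute q a b) hQ
  rw [map_mul, substitute_linearForm hab, zero_mul] at hS
  have hev : ∀ z : σ → ℂ, eval (Function.update z b (q * z a)) (linearForm a' b') = 0 := by
    intro z
    rw [← eval_substitute, hS, map_zero]
  simp only [linearForm, map_sub, map_mul, eval_X, eval_C, Function.update_apply] at hev
  by_cases h1 : b' = b
  · subst h1
    have ha : a' ≠ a := fun h' => h h'.symm rfl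
    have := hev (Pi.single a' 1)
    simp [hab', ha.symm, q_ne_zero] at this
  · by_cases h2 : b' = a
    · subst h2
      have := hev (Pi.single b' 1)
      by_cases h3 : a' = b
      · simp [h1, h3, ← pow_two, sub_eq_zero, q_sq_ne_one.symm] at this
      · simp [h1, h3, hab'] at this
    · have := hev (Pi.single b' 1)
      by_cases h3 : a' = b
      · simp [h1, h3, Ne.symm h2] at this
      · simp [h1, h3, hab'] at this

theorem one_le_degreeOf_linearForm {σ : Type*} {a b j : σ} (hab : a ≠ b) (hj : j = a ∨ j = b) :
    1 ≤ degreeOf j (linearForm a b) := by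
  classical
  have hmem : Finsupp.single j 1 ∈ (linearForm a b).support := by
    rw [mem_support_iff, linearForm, coeff_sub, coeff_C_mul, coeff_X, coeff_X]
    rcases hj with rfl | rfl
    · simp [Finsupp.single_left_inj, hab.symm, q_ne_zero]
    · simp [Finsupp.single_left_inj, hab]
  simpa using monomial_le_degreeOf j hmem

theorem eq_C_of_degreeOf_eq_zero {σ : Type*} {P : MvPolynomial σ ℂ}
    (h : ∀ j, degreeOf j P = 0) : ∃ c, P = C c := by
  classical
  refine ⟨coeff 0 P, ?_⟩
  ext m
  rw [coeff_C]
  split_ifs with hm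
  · rw [hm]
  · by_contra hne
    apply hm
    ext j
    have := monomial_le_degreeOf j (mem_support_iff.2 hne)
    rw [h j] at this
    simpa [eq_comm] using this

/-! ### The nested components of the `O(1)` ground state -/

/-- The variables at successive points, starting from `k`. -/
def cyclicValues {R : Type*} [Zero R] {N : ℕ} (k : ℕ) (z : Fin N → R) (x : ℕ) : R :=
  if h : x < N then z ((finRotate N ^ k) ⟨x, h⟩) else 0

theorem cyclicValues_of_lt {R : Type*} [Zero R] {N : ℕ} (k : ℕ) (z : Fin N → R) {x : ℕ}
    (h : x < N) : cyclicValues k z x = z ((finRotate N ^ k) ⟨x, h⟩) := dif_pos h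

/-- The product of `w_y - q w_x` over the pairs `x < y` in one half of `0, ..., 2n - 1`. -/
noncomputable def halvesProd (n : ℕ) (w : ℕ → ℂ) : ℂ :=
  ∏ y ∈ Finset.range n, ∏ x ∈ Finset.range y, (w y - q * w x) * (w (n + y) - q * w (n + x))

theorem halvesProd_congr {n : ℕ} {w w' : ℕ → ℂ} (h : ∀ x < 2 * n, w x = w' x) :
    halvesProd n w = halvesProd n w' := by
  refine Finset.prod_congr rfl fun y hy => Finset.prod_congr rfl fun x hx => ?_
  rw [Finset.mem_range] at hx hy
  rw [h y (by omega), h x (by omega), h (n + y) (by omega), h (n + x) (by omega)]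

theorem halvesProd_succ (n : ℕ) (w : ℕ → ℂ) :
    halvesProd (n + 1) w = halvesProd n (fun x => w (x + 1)) *
      ((∏ x ∈ Finset.range n, (w (x + 1) - q * w 0)) *
        ∏ x ∈ Finset.range n, (w (2 * n + 1) - q * w (n + x + 1))) := by
  simp only [halvesProd, Finset.prod_mul_distrib]
  rw [Finset.prod_range_succ' (fun y => ∏ x ∈ Finset.range y, (w y - q * w x)),
    Finset.prod_range_succ (fun y => ∏ x ∈ Finset.range y, (w (n + 1 + y) - q * w (n + 1 + x)))]
  simp only [Finset.prod_range_succ' (fun x => w (_ + 1) - q * w x), Finset.prod_mul_distrib,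
    Finset.range_zero, Finset.prod_empty, mul_one]
  have e1 : ∀ x, n + 1 + x = n + x + 1 := fun x => by omega
  have e2 : n + n + 1 = 2 * n + 1 := by omega
  simp only [e1, e2]
  ring

theorem halvesProd_one (n : ℕ) {w : ℕ → ℂ} (hw : ∀ x < 2 * n, w x = 1) :
    (-q ^ 2) ^ (n * (n - 1) / 2) * halvesProd n w = 3 ^ (n * (n - 1) / 2) := by
  rw [halvesProd_congr (w' := fun _ => 1) hw, halvesProd]
  simp only [Finset.prod_const, Finset.card_range, mul_one]
  rw [Finset.prod_pow_eq_pow_sum, Finset.sum_range_id, ← mul_pow]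
  congr 1
  linear_combination -q_sq + (2 - q) * q_cubed

/-- At t = z_j = 1 the weight of `se` vanishes. Only the row of tiles `sw` remains: it rotates the
pattern, and its weight (q - 1)^{2n} equals the eigenvalue. -/
theorem IsGroundStateO1.eval_rotate {n : ℕ}
    {Φ : LinkPattern (2 * n) → MvPolynomial (Fin (2 * n)) ℂ}
    (h : IsGroundStateO1 n Φ) (p : LinkPattern (2 * n)) :
    eval 1 (Φ (rotate p)) = eval 1 (Φ p) := by
  classical
  have hev := congrFun (h.eigenvector 1 1) (rotate p)
  simp only [Matrix.mulVec, dotProduct, transferMatrixO1, Matrix.of_apply, Pi.smul_apply,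
    smul_eq_mul, Pi.one_apply, mul_one, Finset.prod_const] at hev
  have hrow : ∀ p', (∑ s : Fin (2 * n) → Tile, if AddRow s p' (rotate p) then
      ∏ j, faceWeightO1 1 1 (s j) else 0) =
      if p' = p then (q - 1) ^ (2 * n) else 0 := by
    intro p'
    rw [Finset.sum_eq_single (fun _ => Tile.sw)]
    · rw [addRow_sw_rotate_iff]
      simp [faceWeightO1]
    · intro s _ hs
      obtain ⟨j, hj⟩ := Function.ne_iff.1 hs
      have hj' : s j = .se := by cases h : s j <;> simp_all
      split_ifs
      · exact Finset.prod_eq_zero (Finset.mem_univ j) (by simp [hj', faceWeightO1])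
      · rfl
    · simp
  simp only [hrow, ite_mul, zero_mul, Finset.sum_ite_eq', Finset.mem_univ, if_true,
    Finset.card_univ, Fintype.card_fin] at hev
  exact (mul_left_cancel₀ (pow_ne_zero _ (sub_ne_zero.2 q_ne_one)) hev).symm

theorem IsGroundStateO1.eval_rotatedNested {n : ℕ}
    {Φ : LinkPattern (2 * n) → MvPolynomial (Fin (2 * n)) ℂ} (h : IsGroundStateO1 n Φ) (k : ℕ) :
    eval 1 (Φ (rotatedNested n k)) = 3 ^ (n * (n - 1) / 2) := by
  induction k with
  | zero => exact h.normalised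
  | succ k ih => rw [rotatedNested, Function.iterate_succ_apply', h.eval_rotate]; exact ih

/-- The nested components vanish when two parameters in the same half have ratio `q`. -/
theorem IsGroundStateO1.linearForm_dvd {n : ℕ}
    {Φ : LinkPattern (2 * n) → MvPolynomial (Fin (2 * n)) ℂ} (h : IsGroundStateO1 n Φ) (k : ℕ)
    {x y : ℕ} (hxy : x < y) (hx : x < 2 * n) (hy : y < 2 * n) (hhalf : n ≤ x ∨ y < n) :
    linearForm ((finRotate (2 * n) ^ k) ⟨x, hx⟩) ((finRotate (2 * n) ^ k) ⟨y, hy⟩) ∣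
      Φ (rotatedNested n k) := by
  classical
  apply linearForm_dvd_of_substitute_eq_zero
  set a := (finRotate (2 * n) ^ k) ⟨x, hx⟩ with ha
  set b := (finRotate (2 * n) ^ k) ⟨y, hy⟩ with hb
  have hab : a ≠ b := by
    rw [ha, hb, Ne, EmbeddingLike.apply_eq_iff_eq, Fin.ext_iff]
    exact hxy.ne
  -- The first factor is the eigenvalue at t = z_b on z_b = q z_a. There `sw` has weight zero in
  -- column a and `se` in column b, so no row of non-zero weight produces the nested pattern.
  have hmul : (∏ j, (C (q ^ 2) * X a - substitute q a b (X j))) *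
      substitute q a b (Φ (rotatedNested n k)) = 0 := by
    apply MvPolynomial.funext
    intro z
    rw [map_zero, map_mul, eval_prod, eval_substitute]
    set z' := Function.update z b (q * z a) with hz'
    have hza : z' a = z a := by simp [hz', hab]
    have hzb : z' b = q * z a := by simp [hz']
    have hev := congrFun (h.eigenvector (z' b) z') (rotatedNested n k)
    simp only [Pi.smul_apply, smul_eq_mul] at hev
    have hprod : ∏ j, eval z (C (q ^ 2) * X a - substitute q a b (X j)) =
        ∏ j, (q * z' b - z' j) := by
      refine Finset.prod_congr rfl fun j _ => ?_
      rw [map_sub, eval_substitute, eval_X, map_mul, eval_C, eval_X, ← hz', hzb]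
      ring
    rw [hprod, ← hev]
    refine Finset.sum_eq_zero fun p _ => ?_
    simp only [transferMatrixO1, Matrix.of_apply]
    rw [Finset.sum_eq_zero, zero_mul]
    intro s _
    split_ifs with hs
    · by_contra hne
      rw [← ne_eq, Finset.prod_ne_zero_iff] at hne
      refine not_addRow_rotatedNested hxy hx hy hhalf ?_ ?_ hs
      · have := hne a (Finset.mem_univ a)
        rw [← ha]
        cases hsa : s a with
        | se => rfl
        | sw => simp [hsa, faceWeightO1, hza, hzb] at this
      · have := hne b (Finset.mem_univ b)
        rw [← hb]
        cases hsb : s b with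
        | sw => rfl
        | se => simp [hsb, faceWeightO1] at this
    · rfl
  refine (mul_eq_zero.1 hmul).resolve_left (Finset.prod_ne_zero_iff.2 fun j _ h0 => ?_)
  have := congrArg (eval (1 : Fin (2 * n) → ℂ)) h0
  rw [map_sub, eval_substitute, eval_X, map_mul, eval_C, eval_X, Function.update_apply] at this
  simp only [Pi.one_apply, mul_one, map_zero, sub_eq_zero] at this
  split_ifs at this
  · rw [pow_two] at this
    exact q_ne_one (mul_left_cancel₀ q_ne_zero (this.trans (mul_one _).symm))
  · exact q_sq_ne_one this

/-- The nested components of the `O(1)` ground state. -/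
theorem IsGroundStateO1.eval_rotatedNested_eq {n : ℕ}
    {Φ : LinkPattern (2 * n) → MvPolynomial (Fin (2 * n)) ℂ} (h : IsGroundStateO1 n Φ) (k : ℕ)
    (z : Fin (2 * n) → ℂ) :
    eval z (Φ (rotatedNested n k)) =
      (-q ^ 2) ^ (n * (n - 1) / 2) * halvesProd n (cyclicValues k z) := by
  classical
  let V : ℕ → MvPolynomial (Fin (2 * n)) ℂ := cyclicValues k X
  -- Pairs x < y < n, with an offset 0 or n that selects the half.
  let T : Finset ((Σ _ : ℕ, ℕ) × ℕ) := (Finset.range n).sigma Finset.range ×ˢ {0, n}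
  let f : (Σ _ : ℕ, ℕ) × ℕ → MvPolynomial (Fin (2 * n)) ℂ :=
    fun t => V (t.2 + t.1.1) - C q * V (t.2 + t.1.2)
  have hT : ∀ t ∈ T, t.1.2 < t.1.1 ∧ t.1.1 < n ∧ (t.2 = 0 ∨ t.2 = n) := by
    intro t ht
    simp only [T, Finset.mem_product, Finset.mem_sigma, Finset.mem_range, Finset.mem_insert,
      Finset.mem_singleton] at ht
    exact ⟨ht.1.2, ht.1.1, ht.2⟩
  have hf : ∀ t ∈ T, ∃ (hx : t.2 + t.1.2 < 2 * n) (hy : t.2 + t.1.1 < 2 * n),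
      f t = linearForm ((finRotate (2 * n) ^ k) ⟨_, hx⟩) ((finRotate (2 * n) ^ k) ⟨_, hy⟩) := by
    intro t ht
    obtain ⟨h1, h2, h3⟩ := hT t ht
    refine ⟨by omega, by omega, ?_⟩
    simp only [f, V]
    rw [cyclicValues_of_lt _ _ (by omega), cyclicValues_of_lt _ _ (by omega)]
    rfl
  have hne : ∀ {x y : ℕ} (hx : x < 2 * n) (hy : y < 2 * n), x ≠ y →
      (finRotate (2 * n) ^ k) ⟨x, hx⟩ ≠ (finRotate (2 * n) ^ k) ⟨y, hy⟩ := by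
    intro x y hx hy hxy h
    rw [EmbeddingLike.apply_eq_iff_eq, Fin.ext_iff] at h
    exact hxy h
  have hdvd : ∏ t ∈ T, f t ∣ Φ (rotatedNested n k) := by
    apply Finset.prod_dvd_of_isRelPrime
    · intro t ht t' ht' htt'
      obtain ⟨hx, hy, e⟩ := hf t ht
      obtain ⟨hx', hy', e'⟩ := hf t' ht'
      obtain ⟨h1, h2, h3⟩ := hT t ht
      obtain ⟨h1', h2', h3'⟩ := hT t' ht'
      change IsRelPrime (f t) (f t')
      rw [e, e']
      refine isRelPrime_linearForm (hne _ _ (by omega)) (hne _ _ (by omega)) fun h4 h5 => htt' ?_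
      rw [EmbeddingLike.apply_eq_iff_eq, Fin.ext_iff] at h4 h5
      simp only at h4 h5
      obtain ⟨⟨y, x⟩, u⟩ := t
      obtain ⟨⟨y', x'⟩, u'⟩ := t'
      simp only at *
      obtain rfl : u = u' := by omega
      obtain rfl : x = x' := by omega
      obtain rfl : y = y' := by omega
      rfl
    · intro t ht
      obtain ⟨hx, hy, e⟩ := hf t ht
      obtain ⟨h1, h2, h3⟩ := hT t ht
      rw [e]
      exact h.linearForm_dvd k (by omega) hx hy (by omega)
  obtain ⟨Q, hQ⟩ := hdvd
  have hf0 : ∀ t ∈ T, f t ≠ 0 := by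
    intro t ht
    obtain ⟨hx, hy, e⟩ := hf t ht
    rw [e]
    exact linearForm_ne_zero (hne _ _ (by have := hT t ht; omega))
  have hprod : ∀ z : Fin (2 * n) → ℂ,
      ∏ t ∈ T, eval z (f t) = halvesProd n (cyclicValues k z) := by
    intro z
    have hV : ∀ x, eval z (V x) = cyclicValues k z x := by
      intro x
      simp only [V, cyclicValues]
      split_ifs
      · rw [eval_X]
      · rw [map_zero]
    rw [Finset.prod_product, Finset.prod_sigma]
    refine Finset.prod_congr rfl fun y hy => Finset.prod_congr rfl fun x hx => ?_
    rw [Finset.mem_range] at hy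
    rw [Finset.prod_pair (by omega)]
    simp only [f, map_sub, map_mul, eval_C, hV, zero_add]
  -- Every point is paired with the n - 1 others of its half, so the factors exhaust the degree
  -- bound and the cofactor is constant.
  have hdeg : ∀ j, n - 1 ≤ degreeOf j (∏ t ∈ T, f t) := by
    intro j
    obtain ⟨w, rfl⟩ := (finRotate (2 * n) ^ k).surjective j
    obtain ⟨u, v, hu, hv, hw⟩ : ∃ u v, (u = 0 ∨ u = n) ∧ v < n ∧ (w : ℕ) = u + v := by
      have := w.2
      by_cases hwn : (w : ℕ) < n
      · exact ⟨0, w, Or.inl rfl, hwn, (zero_add _).symm⟩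
      · exact ⟨n, w - n, Or.inr rfl, by omega, by omega⟩
    rw [degreeOf_prod_eq _ _ hf0]
    let P : Finset ((Σ _ : ℕ, ℕ) × ℕ) :=
      ((Finset.range n).erase v).image fun x => (⟨max x v, min x v⟩, u)
    have hPT : ∀ t ∈ P, t ∈ T ∧ (t.2 + t.1.2 = w ∨ t.2 + t.1.1 = w) := by
      intro t ht
      obtain ⟨x, hx, rfl⟩ := Finset.mem_image.1 ht
      rw [Finset.mem_erase, Finset.mem_range] at hx
      simp only [T, Finset.mem_product, Finset.mem_sigma, Finset.mem_range, Finset.mem_insert,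
        Finset.mem_singleton]
      omega
    have hcard : P.card = n - 1 := by
      rw [Finset.card_image_of_injOn, Finset.card_erase_of_mem (Finset.mem_range.2 hv),
        Finset.card_range]
      intro x _ y _ hxy
      simp only [Prod.mk.injEq, Sigma.mk.injEq, heq_eq_eq, and_true] at hxy
      omega
    rw [← hcard, Finset.card_eq_sum_ones]
    refine (Finset.sum_le_sum fun t ht => ?_).trans
      (Finset.sum_le_sum_of_subset fun t ht => (hPT t ht).1)
    obtain ⟨ht1, ht2⟩ := hPT t ht
    obtain ⟨hx, hy, e⟩ := hf t ht1
    rw [e]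
    refine one_le_degreeOf_linearForm (hne _ _ (by have := hT t ht1; omega)) ?_
    simpa only [EmbeddingLike.apply_eq_iff_eq, Fin.ext_iff, eq_comm] using ht2
  obtain ⟨c, rfl⟩ : ∃ c, Q = C c := by
    by_cases hQ0 : Q = 0
    · exact ⟨0, by rw [hQ0, C_0]⟩
    apply eq_C_of_degreeOf_eq_zero
    intro j
    have h1 := h.degree (rotatedNested n k) j
    rw [hQ, degreeOf_mul_eq (Finset.prod_ne_zero_iff.2 hf0) hQ0] at h1
    have := hdeg j
    omega
  have h1 := h.eval_rotatedNested k
  have hone := halvesProd_one n (w := cyclicValues k (1 : Fin (2 * n) → ℂ))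
    (fun x hx => by rw [cyclicValues_of_lt _ _ hx]; rfl)
  rw [hQ, map_mul, eval_prod, hprod, eval_C, ← hone, mul_comm] at h1
  rw [hQ, map_mul, eval_prod, hprod, eval_C, mul_comm]
  congr 1
  refine mul_right_cancel₀ (fun h0 => ?_) h1
  rw [h0, mul_zero] at hone
  exact pow_ne_zero _ (by norm_num) hone.symm

open MvPolynomial

/-! ### The recursion -/

/-- The recursion for the nested components of the `O(1)` ground state. -/
theorem IsGroundStateO1.eval_rotatedNested_succ {n : ℕ}
    {Φ : LinkPattern (2 * (n + 1)) → MvPolynomial (Fin (2 * (n + 1))) ℂ}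
    {Φ' : LinkPattern (2 * n) → MvPolynomial (Fin (2 * n)) ℂ} (hΦ : IsGroundStateO1 (n + 1) Φ)
    (hΦ' : IsGroundStateO1 n Φ') (i : Fin (2 * n + 2)) (z : Fin (2 * n + 2) → ℂ)
    (hz : z (finRotate (2 * n + 2) i) = q * z i) :
    eval z (Φ (rotatedNested (n + 1) (i + 1))) =
      (∏ k : Fin (2 * n), q * (z (finRotate (2 * n + 2) i) - q ^ 2 * z (skip i k))) *
        eval (fun k => z (skip i k)) (Φ' (rotatedNested n (min (i : ℕ) (2 * n)))) := by
  set w : ℕ → ℂ := cyclicValues ((i : ℕ) + 1) z with hw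
  have hw0 : w 0 = z (finRotate (2 * n + 2) i) := by
    rw [hw, cyclicValues_of_lt _ _ (by omega)]
    exact congrArg z (finRotate_pow_zero i)
  have hw1 : w (2 * n + 1) = z i := by
    rw [hw, cyclicValues_of_lt _ _ (by omega)]
    exact congrArg z (finRotate_pow_last i)
  have hw2 : ∀ y : Fin (2 * n),
      z (skip i ((finRotate (2 * n) ^ min (i : ℕ) (2 * n)) y)) = w (y + 1) := by
    intro y
    rw [hw, cyclicValues_of_lt _ _ (by omega)]
    exact congrArg z (skip_finRotate_pow i y)
  have hw3 : halvesProd n (cyclicValues (min (i : ℕ) (2 * n)) fun k => z (skip i k)) =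
      halvesProd n fun x => w (x + 1) :=
    halvesProd_congr fun x hx => by
      rw [cyclicValues_of_lt _ _ hx]
      exact hw2 ⟨x, hx⟩
  have hw4 : w 0 = q * w (2 * n + 1) := by rw [hw0, hw1, hz]
  have hK : ∏ k : Fin (2 * n), q * (z (finRotate (2 * n + 2) i) - q ^ 2 * z (skip i k)) =
      (-q ^ 2) ^ n * ((∏ x ∈ Finset.range n, (w (x + 1) - q * w 0)) *
        ∏ x ∈ Finset.range n, (w (2 * n + 1) - q * w (n + x + 1))) := by
    rw [← Equiv.prod_comp (finRotate (2 * n) ^ min (i : ℕ) (2 * n))]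
    simp_rw [hw2, ← hw0]
    rw [Fin.prod_univ_eq_prod_range (fun x => q * (w 0 - q ^ 2 * w (x + 1))), two_mul,
      Finset.prod_range_add, ← two_mul]
    -- The factors of the prefactor match those of `halvesProd_succ` up to -1 in the first half and,
    -- since w_0 = q w_{2n+1}, up to q² in the second. Together these signs and powers give (-q²)^n,
    -- the change in the scalar.
    have h1 : ∀ x, q * (w 0 - q ^ 2 * w (x + 1)) = -1 * (w (x + 1) - q * w 0) := fun x => by
      linear_combination -w (x + 1) * q_cubed
    have h2 : ∀ x, q * (w 0 - q ^ 2 * w (n + x + 1)) =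
        q ^ 2 * (w (2 * n + 1) - q * w (n + x + 1)) := fun x => by
      linear_combination q * hw4
    rw [Finset.prod_congr rfl fun x _ => h1 x, Finset.prod_congr rfl fun x _ => h2 x]
    simp_rw [Finset.prod_mul_distrib, Finset.prod_const, Finset.card_range]
    rw [neg_pow (q ^ 2) n]
    ring
  have e1 : (n + 1) * (n + 1 - 1) / 2 = n * (n - 1) / 2 + n := by
    have h3 := Finset.sum_range_id n
    have h4 := Finset.sum_range_id (n + 1)
    rw [Finset.sum_range_succ] at h4
    omega
  have hL := hΦ.eval_rotatedNested_eq (i + 1) z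
  have hR := hΦ'.eval_rotatedNested_eq (min (i : ℕ) (2 * n)) fun k => z (skip i k)
  rw [hR, hL, hw3, hK, e1, pow_add]
  change _ * halvesProd (n + 1) w = _
  rw [halvesProd_succ]
  ring

theorem IsGroundStateO1.eval_rotatedNested_ne_zero {n : ℕ}
    {Φ : LinkPattern (2 * n) → MvPolynomial (Fin (2 * n)) ℂ} (hΦ : IsGroundStateO1 n Φ) (k : ℕ)
    {z : Fin (2 * n) → ℂ} (hz : ∀ j l, z j ≠ q * z l) :
    eval z (Φ (rotatedNested n k)) ≠ 0 := by
  rw [hΦ.eval_rotatedNested_eq]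
  refine mul_ne_zero (pow_ne_zero _ (neg_ne_zero.2 (pow_ne_zero _ q_ne_zero)))
    (Finset.prod_ne_zero_iff.2 fun y hy => Finset.prod_ne_zero_iff.2 fun x hx => ?_)
  rw [Finset.mem_range] at hx hy
  rw [cyclicValues_of_lt _ _ (by omega), cyclicValues_of_lt _ _ (by omega),
    cyclicValues_of_lt _ _ (by omega), cyclicValues_of_lt _ _ (by omega)]
  exact mul_ne_zero (sub_ne_zero.2 (hz _ _)) (sub_ne_zero.2 (hz _ _))

/-- All weights except ω_A share the factor z + q w, which vanishes at w = -q² z. -/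
theorem eq_se_of_faceWeight_ne_zero {z : ℂ} {a b : Tile}
    (h : faceWeight z (-q ^ 2 * z) a b ≠ 0) : a = .se ∧ b = .se := by
  have hzero : z + q * (-q ^ 2 * z) = 0 := by linear_combination -z * q_cubed
  cases a <;> cases b <;>
    simp only [faceWeight, omegaD, omegaR, omegaL, hzero, mul_zero, ne_eq, not_true_eq_false] at h
  exact ⟨rfl, rfl⟩

/-- All weights except ω_D share the factor w - z. -/
theorem eq_sw_of_faceWeight_ne_zero {z : ℂ} {a b : Tile} (h : faceWeight z z a b ≠ 0) :
    a = .sw ∧ b = .sw := by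
  cases a <;> cases b <;>
    simp only [faceWeight, omegaA, omegaR, omegaL, sub_self, zero_mul, ne_eq,
      not_true_eq_false] at h
  exact ⟨rfl, rfl⟩

/-- An eigenvector whose parameters satisfy `z_{i+1} = -q² z_i` is supported on the configurations
with a red and a green arc joining `i` and `i + 1`. -/
theorem eq_zero_of_forall_insertArc_ne {m : ℕ} {i : Fin (m + 2)} {z : Fin (m + 2) → ℂ}
    (hz : z (finRotate (m + 2) i) = -q ^ 2 * z i) {v : Configuration (m + 2) → ℂ}
    (hv : (transferMatrix (z (finRotate (m + 2) i)) z).mulVec v =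
      (∏ j, (q * z (finRotate (m + 2) i) ^ 2 - z j ^ 2)) • v)
    (h0 : ∏ j, (q * z (finRotate (m + 2) i) ^ 2 - z j ^ 2) ≠ 0) {π : Configuration (m + 2)}
    (hπ : ∀ ρ : Configuration m, (insertArc i ρ.1, insertArc i ρ.2) ≠ π) : v π = 0 := by
  classical
  have h := congrFun hv π
  rw [Pi.smul_apply, smul_eq_mul] at h
  refine (mul_eq_zero.1 (h.symm.trans (Finset.sum_eq_zero fun π' _ => ?_))).resolve_left h0
  simp only [transferMatrix, Matrix.of_apply]
  rw [Finset.sum_eq_zero, zero_mul]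
  refine fun r _ => Finset.sum_eq_zero fun g _ => ?_
  split_ifs with hrg
  · by_contra hne
    rw [← ne_eq, Finset.prod_ne_zero_iff] at hne
    have h1 : r i = .se ∧ g i = .se := by
      have := hne i (Finset.mem_univ i)
      rw [hz] at this
      exact eq_se_of_faceWeight_ne_zero this
    have h2 : r (finRotate (m + 2) i) = .sw ∧ g (finRotate (m + 2) i) = .sw :=
      eq_sw_of_faceWeight_ne_zero (hne (finRotate (m + 2) i) (Finset.mem_univ _))
    obtain ⟨ρ₁, hρ₁⟩ := exists_insertArc_eq (hrg.1.small_arc h1.1 h2.1)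
    obtain ⟨ρ₂, hρ₂⟩ := exists_insertArc_eq (hrg.2.small_arc h1.2 h2.2)
    exact hπ (ρ₁, ρ₂) (Prod.ext hρ₁ hρ₂)
  · rfl

theorem insertArc_pair_injective {m : ℕ} (i : Fin (m + 2)) :
    Function.Injective fun ρ : Configuration m => (insertArc i ρ.1, insertArc i ρ.2) := by
  intro ρ ρ' h
  rw [Prod.mk.injEq] at h
  exact Prod.ext (insertArc_injective i h.1) (insertArc_injective i h.2)

/-- The restriction of such an eigenvector to these configurations is an eigenvector of the
transfer matrix without the two columns. -/
theorem transferMatrix_mulVec_insertArc {m : ℕ} {i : Fin (m + 2)} {z : Fin (m + 2) → ℂ}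
    (hz : z (finRotate (m + 2) i) = -q ^ 2 * z i) {v : Configuration (m + 2) → ℂ} {t : ℂ}
    (hv : (transferMatrix t z).mulVec v = (∏ j, (q * t ^ 2 - z j ^ 2)) • v)
    (h0 : ∀ π, (∀ ρ : Configuration m, (insertArc i ρ.1, insertArc i ρ.2) ≠ π) → v π = 0)
    (h1 : q * t ^ 2 - z i ^ 2 ≠ 0) (h2 : q * t ^ 2 - z (finRotate (m + 2) i) ^ 2 ≠ 0) :
    (transferMatrix t fun k => z (skip i k)).mulVec
        (fun ρ => v (insertArc i ρ.1, insertArc i ρ.2)) =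
      (∏ k, (q * t ^ 2 - z (skip i k) ^ 2)) •
        fun ρ : Configuration m => v (insertArc i ρ.1, insertArc i ρ.2) := by
  funext ρ'
  have h := congrFun hv (insertArc i ρ'.1, insertArc i ρ'.2)
  rw [Pi.smul_apply, smul_eq_mul, prod_eq_mul_prod_skip i] at h
  have hsum : (transferMatrix t z).mulVec v (insertArc i ρ'.1, insertArc i ρ'.2) =
      ∑ ρ : Configuration m, transferMatrix t z (insertArc i ρ'.1, insertArc i ρ'.2)
        (insertArc i ρ.1, insertArc i ρ.2) * v (insertArc i ρ.1, insertArc i ρ.2) := by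
    symm
    refine Fintype.sum_of_injective _ (insertArc_pair_injective i) _ _ (fun π hπ => ?_)
      fun _ => rfl
    rw [h0 π fun ρ hρ => hπ ⟨ρ, hρ⟩, mul_zero]
  rw [hsum] at h
  simp only [transferMatrix_insertArc i t z hz, mul_assoc] at h
  rw [← Finset.mul_sum, ← Finset.mul_sum] at h
  exact mul_left_cancel₀ h2 (mul_left_cancel₀ h1 h)

theorem insertArcs_apply_insertArc {m : ℕ} (i : Fin (m + 2)) (v : Configuration m → ℂ)
    (ρ : Configuration m) : insertArcs i v (insertArc i ρ.1, insertArc i ρ.2) = v ρ := by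
  classical
  simp only [insertArcs, Matrix.mulVecLin_apply, Matrix.mulVec, dotProduct, Matrix.of_apply]
  rw [Finset.sum_eq_single ρ]
  · rw [if_pos ⟨isInsertion_insertArc i _, isInsertion_insertArc i _⟩, one_mul]
  · intro ρ' _ hne
    rw [if_neg, zero_mul]
    rintro ⟨h1, h2⟩
    rw [isInsertion_iff] at h1 h2
    exact hne (Prod.ext (insertArc_injective i h1.symm) (insertArc_injective i h2.symm))
  · simp

theorem insertArcs_apply_eq_zero {m : ℕ} (i : Fin (m + 2)) (v : Configuration m → ℂ)
    {π : Configuration (m + 2)}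
    (hπ : ∀ ρ : Configuration m, (insertArc i ρ.1, insertArc i ρ.2) ≠ π) :
    insertArcs i v π = 0 := by
  classical
  simp only [insertArcs, Matrix.mulVecLin_apply, Matrix.mulVec, dotProduct, Matrix.of_apply]
  refine Finset.sum_eq_zero fun ρ _ => ?_
  rw [if_neg, zero_mul]
  rintro ⟨h1, h2⟩
  rw [isInsertion_iff] at h1 h2
  exact hπ ρ (Prod.ext h1.symm h2.symm)

theorem prod_sdiff_eq_prod_skip {M : Type*} [CommMonoid M] {m : ℕ} (i : Fin (m + 2))
    (f : Fin (m + 2) → M) :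
    ∏ j ∈ Finset.univ \ {i, finRotate (m + 2) i}, f j = ∏ k, f (skip i k) := by
  symm
  refine Finset.prod_bij (fun k _ => skip i k) ?_ ?_ ?_ fun _ _ => rfl
  · intro k _
    simp [skip_ne, skip_ne_finRotate, -finRotate_apply]
  · exact fun _ _ _ _ h => skip_injective i h
  · intro j hj
    simp only [Finset.mem_sdiff, Finset.mem_univ, true_and, Finset.mem_insert,
      Finset.mem_singleton, not_or] at hj
    obtain ⟨k, hk⟩ := exists_skip_eq hj.1 hj.2
    exact ⟨k, Finset.mem_univ _, hk⟩

/-- In the regime of positive weights an eigenvector is determined by one of its partial sums. -/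
theorem eq_zero_of_sum_eq_zero {n : ℕ} {z : Fin (2 * n) → ℂ} (hz : ∀ j, z j ∈ regime)
    {u w : Configuration (2 * n) → ℂ}
    (hu : (transferMatrix 1 z).mulVec u = (∏ j, (q - z j ^ 2)) • u)
    (hw : (transferMatrix 1 z).mulVec w = (∏ j, (q - z j ^ 2)) • w) (ρ : LinkPattern (2 * n))
    (hu0 : ∑ γ, u (ρ, γ) = 0) (hw0 : ∑ γ, w (ρ, γ) ≠ 0) : u = 0 := by
  set π : Configuration (2 * n) := (smallArcs n, smallArcs n)
  -- This combination vanishes on the configuration of small arcs, hence everywhere; summing it over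
  -- γ then gives u π = 0.
  have h := eq_zero_of_smallArcs hz (u := w π • u - u π • w) (by
    rw [Matrix.mulVec_sub, Matrix.mulVec_smul, Matrix.mulVec_smul, hu, hw, smul_sub,
      smul_comm (w π), smul_comm (u π)]) (by
    simp only [Pi.sub_apply, Pi.smul_apply, smul_eq_mul]
    ring)
  refine eq_zero_of_smallArcs hz hu ?_
  have h1 : ∑ γ, (w π • u - u π • w) (ρ, γ) = 0 := by
    simp only [h, Pi.zero_apply, Finset.sum_const_zero]
  simp only [Pi.sub_apply, Pi.smul_apply, smul_eq_mul, Finset.sum_sub_distrib,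
    ← Finset.mul_sum, hu0, mul_zero, zero_sub, neg_eq_zero, mul_eq_zero, hw0, or_false] at h1
  exact h1

theorem recursion_of_mem_regime {n : ℕ}
    {Ψ : Configuration (2 * (n + 1)) → MvPolynomial (Fin (2 * (n + 1))) ℂ}
    {Ψ' : Configuration (2 * n) → MvPolynomial (Fin (2 * n)) ℂ}
    (hΨ : IsGroundState (n + 1) Ψ) (hΨ' : IsGroundState n Ψ') (i : Fin (2 * n + 2))
    {z : Fin (2 * n + 2) → ℂ} (hz : z (finRotate (2 * n + 2) i) = -q ^ 2 * z i)
    (hzi : z i ∈ regime) (hzk : ∀ k, z (skip i k) ∈ regime) (π : Configuration (2 * n + 2)) :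
    eval z (Ψ π) = (∏ k, q * (z (finRotate (2 * n + 2) i) ^ 2 - q ^ 2 * z (skip i k) ^ 2)) *
      insertArcs i (fun ρ => eval (fun k => z (skip i k)) (Ψ' ρ)) π := by
  set K := ∏ k, q * (z (finRotate (2 * n + 2) i) ^ 2 - q ^ 2 * z (skip i k) ^ 2)
  have hz2 : z (finRotate (2 * n + 2) i) ^ 2 = q * z i ^ 2 := by
    rw [hz]
    linear_combination q * z i ^ 2 * q_cubed
  let v : Configuration (2 * n + 2) → ℂ := fun π => eval z (Ψ π)
  have hv : ∀ t, (transferMatrix t z).mulVec v = (∏ j, (q * t ^ 2 - z j ^ 2)) • v :=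
    fun t => hΨ.eigenvector t z
  let w : Configuration (2 * n) → ℂ := fun ρ => eval (fun k => z (skip i k)) (Ψ' ρ)
  have hzi0 : z i ^ 2 ≠ 0 := pow_ne_zero _ (ne_zero_of_mem_regime hzi)
  have hsupp : ∀ π, (∀ ρ : Configuration (2 * n), (insertArc i ρ.1, insertArc i ρ.2) ≠ π) →
      v π = 0 := by
    intro π hπ
    refine eq_zero_of_forall_insertArc_ne hz (hv _) ?_ hπ
    rw [hz2, prod_eq_mul_prod_skip i, hz2]
    refine mul_ne_zero (mul_ne_zero ?_ ?_) (Finset.prod_ne_zero_iff.2 fun k _ => ?_)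
    · have : q * (q * z i ^ 2) - z i ^ 2 = (q ^ 2 - 1) * z i ^ 2 := by ring
      rw [this]
      exact mul_ne_zero (sub_ne_zero.2 q_sq_ne_one) hzi0
    · have : q * (q * z i ^ 2) - q * z i ^ 2 = q * (q - 1) * z i ^ 2 := by ring
      rw [this]
      exact mul_ne_zero (mul_ne_zero q_ne_zero (sub_ne_zero.2 q_ne_one)) hzi0
    · intro h
      refine ne_q_mul_of_mem_regime hzi (hzk k) ?_
      linear_combination q * h - z i ^ 2 * q_cubed
  -- Cancelling the column i + 1 at t = 1 needs q - z_{i+1}² = q (1 - z_i²) ≠ 0; this is why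
  -- `regime` excludes z² = 1.
  have hχ := transferMatrix_mulVec_insertArc hz (hv 1) hsupp
    (by rw [one_pow, mul_one]; exact sub_ne_zero_of_mem_regime hzi) (by
      rw [hz2, ← mul_sub, one_pow]
      exact mul_ne_zero q_ne_zero (sub_ne_zero.2 hzi.2.1.symm))
  have hw := hΨ'.eigenvector 1 fun k => z (skip i k)
  rw [one_pow, mul_one] at hχ hw
  obtain ⟨Φ, hΦ, hΦΨ⟩ := hΨ.normalised
  obtain ⟨Φ', hΦ', hΦΨ'⟩ := hΨ'.normalised
  have hw0 := hΦΨ' (rotatedNested n (min (i : ℕ) (2 * n))) fun k => z (skip i k)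
  have hχ0 : ∑ γ, v (insertArc i (rotatedNested n (min (i : ℕ) (2 * n))), insertArc i γ) =
      eval (fun j => z j ^ 2) (Φ (rotatedNested (n + 1) (i + 1))) := by
    rw [insertArc_rotatedNested]
    refine Eq.trans ?_ (hΦΨ _ z)
    refine Fintype.sum_of_injective _ (insertArc_injective i) _ _ (fun γ hγ => ?_) fun _ => rfl
    exact hsupp _ fun ρ hρ => hγ ⟨ρ.2, congrArg Prod.snd hρ⟩
  have hrec := hΦ.eval_rotatedNested_succ hΦ' i (fun j => z j ^ 2) hz2
  -- The difference is an eigenvector whose sum over green patterns vanishes for the nested red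
  -- pattern, by the O(1) recursion. The same sum of w is non-zero, so uniqueness applies.
  have hu : (fun ρ : Configuration (2 * n) => v (insertArc i ρ.1, insertArc i ρ.2)) - K • w = 0 := by
    refine eq_zero_of_sum_eq_zero hzk ?_ hw (rotatedNested n (min (i : ℕ) (2 * n))) ?_ ?_
    · have hw' : (transferMatrix 1 fun k => z (skip i k)).mulVec w =
          (∏ k, (q - z (skip i k) ^ 2)) • w := hw
      rw [Matrix.mulVec_sub, Matrix.mulVec_smul, hχ, hw', smul_sub, smul_comm K]
    · simp only [Pi.sub_apply, Pi.smul_apply, smul_eq_mul, Finset.sum_sub_distrib,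
        ← Finset.mul_sum, w]
      rw [hχ0, hw0, hrec, sub_self]
    · rw [hw0]
      exact hΦ'.eval_rotatedNested_ne_zero _ fun j l => ne_q_mul_of_mem_regime (hzk j) (hzk l)
  by_cases hπ : ∃ ρ : Configuration (2 * n), (insertArc i ρ.1, insertArc i ρ.2) = π
  · obtain ⟨ρ, rfl⟩ := hπ
    rw [insertArcs_apply_insertArc]
    exact sub_eq_zero.1 (congrFun hu ρ)
  · push Not at hπ
    rw [insertArcs_apply_eq_zero i _ hπ, mul_zero]
    exact hsupp π hπ

end RotorModel

/-! ### Extension from the regime to all parameters -/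

theorem mainTheorem9 (n : ℕ)
    (Ψ : RotorModel.Configuration (2 * (n + 1)) → MvPolynomial (Fin (2 * (n + 1))) ℂ)
    (Ψ' : RotorModel.Configuration (2 * n) → MvPolynomial (Fin (2 * n)) ℂ)
    (hΨ : RotorModel.IsGroundState (n + 1) Ψ)
    (hΨ' : RotorModel.IsGroundState n Ψ')
    (i i' : Fin (2 * n + 2)) (hi' : i' = finRotate (2 * n + 2) i)
    (z : Fin (2 * n + 2) → ℂ) (hz : z i' = -RotorModel.q ^ 2 * z i) :
    (fun π : RotorModel.Configuration (2 * n + 2) => MvPolynomial.eval z (Ψ π)) =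
      (∏ j ∈ Finset.univ \ {i, i'},
          RotorModel.q * (z i' ^ 2 - RotorModel.q ^ 2 * z j ^ 2)) •
        RotorModel.insertArcs i
          (fun ρ => MvPolynomial.eval (fun j => z (RotorModel.skip i j)) (Ψ' ρ)) := by
  classical
  subst hi'
  funext π
  rw [Pi.smul_apply, smul_eq_mul, RotorModel.prod_sdiff_eq_prod_skip i
    fun j => RotorModel.q * (z (finRotate (2 * n + 2) i) ^ 2 - RotorModel.q ^ 2 * z j ^ 2)]
  let A : Matrix (RotorModel.Configuration (2 * n + 2)) (RotorModel.Configuration (2 * n)) ℂ :=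
    Matrix.of fun π ρ => if RotorModel.IsInsertion i ρ.1 π.1 ∧ RotorModel.IsInsertion i ρ.2 π.2
      then 1 else 0
  have hA : ∀ v, RotorModel.insertArcs i v π = ∑ ρ, A π ρ * v ρ := fun v => rfl
  -- P and R are the two sides after z_{i+1} is replaced by -q² z_i. The constraint is thereby
  -- removed, and agreement on a product of infinite sets implies equality.
  let P : MvPolynomial (Fin (2 * n + 2)) ℂ :=
    RotorModel.substitute (-RotorModel.q ^ 2) i (finRotate (2 * n + 2) i) (Ψ π)
  let R : MvPolynomial (Fin (2 * n + 2)) ℂ :=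
    (∏ k, .C RotorModel.q * ((.C (-RotorModel.q ^ 2) * .X i) ^ 2 -
      .C (RotorModel.q ^ 2) * .X (RotorModel.skip i k) ^ 2)) *
      ∑ ρ, .C (A π ρ) * MvPolynomial.rename (RotorModel.skip i) (Ψ' ρ)
  have hP : ∀ x : Fin (2 * n + 2) → ℂ, MvPolynomial.eval x P = MvPolynomial.eval
      (Function.update x (finRotate (2 * n + 2) i) (-RotorModel.q ^ 2 * x i)) (Ψ π) :=
    fun x => RotorModel.eval_substitute _ _ _ _ _
  have hR : ∀ x : Fin (2 * n + 2) → ℂ, MvPolynomial.eval x R =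
      (∏ k, RotorModel.q * ((-RotorModel.q ^ 2 * x i) ^ 2 -
        RotorModel.q ^ 2 * x (RotorModel.skip i k) ^ 2)) *
        RotorModel.insertArcs i
          (fun ρ => MvPolynomial.eval (fun j => x (RotorModel.skip i j)) (Ψ' ρ)) π := by
    intro x
    simp only [R, hA, map_mul, map_sum, map_prod, map_sub, map_pow, MvPolynomial.eval_C,
      MvPolynomial.eval_X, MvPolynomial.eval_rename]
    rfl
  have hPR : P = R := by
    refine MvPolynomial.funext_set (fun _ => RotorModel.regime)
      (fun _ => RotorModel.regime_infinite) fun x hx => ?_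
    have hxj : ∀ j, x j ∈ RotorModel.regime := fun j => hx j trivial
    set y := Function.update x (finRotate (2 * n + 2) i) (-RotorModel.q ^ 2 * x i) with hy
    have hyi : y i = x i := Function.update_of_ne (RotorModel.finRotate_ne i).symm _ _
    have hyk : ∀ k, y (RotorModel.skip i k) = x (RotorModel.skip i k) :=
      fun k => Function.update_of_ne (RotorModel.skip_ne_finRotate i k) _ _
    have hyr : y (finRotate (2 * n + 2) i) = -RotorModel.q ^ 2 * x i := Function.update_self _ _ _
    have h := RotorModel.recursion_of_mem_regime hΨ hΨ' i (z := y) (by rw [hyr, hyi])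
      (by rw [hyi]; exact hxj i) (fun k => by rw [hyk]; exact hxj _) π
    simp only [hyr, hyk] at h
    rw [hP, hR, ← h]
  have hzP := hP z
  rw [← hz, Function.update_eq_self, hPR, hR, ← hz] at hzP
  exact hzP.symm
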